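/- Let $\mathcal H_I$ be a finite-dimensional complex Hilbert space, $\{U_\theta\}_{\theta\in\Theta}$ a non-empty finite family of pairwise distinct unitary operators on $\mathcal H_I$ (operators that differ by a phase count as distinct). The unknown operation $U_\theta$ is given as the controlled operation $c\text{-}U_\theta=|0\rangle\langle 0|\otimes\mathbf 1+|1\rangle\langle 1|\otimes U_\theta$ on $\mathcal H_C\otimes\mathcal H_I$, where $\mathcal H_C=\mathbb C^2$ is a control qubit. A protocol consists of a finite-dimensional work space $\mathcal H_W$, an initial unit vector $|\xi\rangle\in\mathcal H_W\otimes\mathcal H_C$, finitely many rounds, and a final projective measurement $\{P_\theta\}_{\theta\in\Theta}$ on $\mathcal H_W\otimes\mathcal H_C$. None of these depends on the true parameter. In a round, first a unitary $A$ acts on $\mathcal H_W\otimes\mathcal H_C$; then, for unitaries $B_1,\dots,B_m$ on $\mathcal H_I$ (with $m\ge 0$ and the $B_j$ fixed by the protocol), one applies in turn $B_1$, $c\text{-}U_\theta$, $B_2$, $c\text{-}U_\theta$, …, $B_m$, $c\text{-}U_\theta$. So a round amounts to one use of a transformed controlled operation, which acts on $\mathcal H_I$ as $U_\theta B_m\cdots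 U_\theta B_1$ if the control is $|1\rangle$ and as $B_m\cdots B_1$ if it is $|0\rangle$. Then for every unit vector $|\psi\rangle\in\mathcal H_I$ and every $\varepsilon>0$ there is a protocol with the following two properties when it is started in $|\xi\rangle\otimes|\psi\rangle$. 1. (No distortion.) There are unitaries $R_0,R_1,R_2,\dots$ on $\mathcal H_I$, independent of $\theta$, such that for every $\theta\in\Theta$ and every $t$ from $0$ to the number of rounds, the reduced state on $\mathcal H_I$ after $t$ rounds is exactly $R_t|\psi\rangle\langle\psi|R_t^\dagger$. 2. (Small error.) For every $\theta\in\Theta$, if the given operation is $c\text{-}U_\theta$, then the final measurement has the outcome $\theta$ with probability larger than $1-\varepsilon$. -/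

import Mathlib

open scoped Kronecker Matrix

noncomputable section

namespace BlackBox

/-- The controlled operation `c-U = |0⟩⟨0| ⊗ 1 + |1⟩⟨1| ⊗ U`, as an operator on
`(H_W ⊗ H_C) ⊗ H_I`, where `H_W = ℂ^W` is the work space, `H_C = ℂ²` the control qubit and
`H_I = ℂ^n` the input space.  It is trivial on the work space. -/
def controlled (W : Type) [DecidableEq W] {n : Type*} [DecidableEq n] (U : Matrix n n ℂ) :
    Matrix ((W × Fin 2) × n) ((W × Fin 2) × n) ℂ :=
  ((1 : Matrix W W ℂ) ⊗ₖ Matrix.single (0 : Fin 2) (0 : Fin 2) (1 : ℂ)) ⊗ₖ (1 : Matrix n n ℂ) +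
    ((1 : Matrix W W ℂ) ⊗ₖ Matrix.single (1 : Fin 2) (1 : Fin 2) (1 : ℂ)) ⊗ₖ U

/-- One round of a protocol.  First the unitary `side` acts on the work space and the control
qubit; then, for each unitary `B` of the list `word` in turn, `B` acts on `H_I` and the black box
`c-U` is called once.  The control qubit is not touched between the calls of one round, so
that a round calls the transformed black box controlled by the same qubit, whose operation is
`U B_m ⋯ U B_2 U B_1` in place of `U` (and `B_m ⋯ B_1` in place of the identity). -/
structure Round (W : Type) [Fintype W] [DecidableEq W] (n : Type*) [Fintype n]
    [DecidableEq n] where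
  side : Matrix.unitaryGroup (W × Fin 2) ℂ
  word : List (Matrix.unitaryGroup n ℂ)

/-- A protocol: an initial pure state of work space and control qubit, a finite list of rounds,
and a final projective measurement of work space and control qubit with outcomes in `Θ`.
None of these depends on the unknown parameter.  No operation acts jointly on `H_I`
and the other systems, except for the black box itself. -/
structure Protocol (W : Type) [Fintype W] [DecidableEq W] (n : Type*) [Fintype n]
    [DecidableEq n] (Θ : Type*) [Fintype Θ] where
  init : W × Fin 2 → ℂ
  init_norm : ∑ a, ‖init a‖ ^ 2 = 1
  rounds : List (Round W n)
  meas : Θ → Matrix (W × Fin 2) (W × Fin 2) ℂ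
  meas_hermitian : ∀ θ, (meas θ).IsHermitian
  meas_idempotent : ∀ θ, meas θ * meas θ = meas θ
  meas_sum : ∑ θ, meas θ = 1

section

variable {W : Type} [Fintype W] [DecidableEq W] {n : Type*} [Fintype n] [DecidableEq n]

/-- Apply `B` to `H_I`, then call the black box `c-U`. -/
def call (U : Matrix n n ℂ) (v : (W × Fin 2) × n → ℂ) (B : Matrix.unitaryGroup n ℂ) :
    (W × Fin 2) × n → ℂ :=
  controlled W U *ᵥ (((1 : Matrix (W × Fin 2) (W × Fin 2) ℂ) ⊗ₖ (B : Matrix n n ℂ)) *ᵥ v)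

/-- The effect of one round on the state vector, when the black box is `c-U`. -/
def Round.run (U : Matrix n n ℂ) (v : (W × Fin 2) × n → ℂ) (r : Round W n) :
    (W × Fin 2) × n → ℂ :=
  r.word.foldl (call U)
    (((r.side : Matrix (W × Fin 2) (W × Fin 2) ℂ) ⊗ₖ (1 : Matrix n n ℂ)) *ᵥ v)

/-- The reduced density matrix on `H_I` (partial trace over work space and control). -/
def reduced (v : (W × Fin 2) × n → ℂ) : Matrix n n ℂ :=
  Matrix.of fun i j => ∑ a, v (a, i) * star (v (a, j))

variable {Θ : Type*} [Fintype Θ]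

/-- The state after the first `t` rounds, when the black box is `c-U` and `H_I` starts in `ψ`. -/
def Protocol.state (P : Protocol W n Θ) (U : Matrix n n ℂ) (ψ : n → ℂ) (t : ℕ) :
    (W × Fin 2) × n → ℂ :=
  (P.rounds.take t).foldl (Round.run U) (fun p => P.init p.1 * ψ p.2)

/-- The probability that the final measurement has the outcome `θ`. -/
def Protocol.prob (P : Protocol W n Θ) (U : Matrix n n ℂ) (ψ : n → ℂ) (θ : Θ) : ℝ :=
  ∑ p, ‖((P.meas θ ⊗ₖ (1 : Matrix n n ℂ)) *ᵥ P.state U ψ P.rounds.length) p‖ ^ 2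

/-- Absence of distortion: at the start and after each round, the reduced state on `H_I` is the
initial state up to a unitary that may depend on the round, but not on the parameter `θ`. -/
def Protocol.DistortionFree (P : Protocol W n Θ) (U : Θ → Matrix.unitaryGroup n ℂ)
    (ψ : n → ℂ) : Prop :=
  ∃ R : ℕ → Matrix.unitaryGroup n ℂ, ∀ t ≤ P.rounds.length, ∀ θ,
    reduced (P.state (U θ : Matrix n n ℂ) ψ t) =
      (R t : Matrix n n ℂ) * Matrix.vecMulVec ψ (star ψ) * (R t : Matrix n n ℂ)ᴴ

end

end BlackBox

end

noncomputable section

namespace BlackBox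

/-! ### Linear isometries: prescribed values, eigenvectors, scalars -/

section Isometries

open Module Module.End

variable {E : Type*} [NormedAddCommGroup E] [InnerProductSpace ℂ E]

/-! The mechanism is phase kickback. Up to a unitary independent of `θ`, a round applies a
controlled product `w θ` of simultaneous conjugates `C⁻¹ * U θ * C` (`exists_word_foldl_call`). If
`ψ` is an eigenvector of every `w θ`, with eigenvalue `c θ`, the state remains a product and only
the control acquires the phase `c θ`; hence there is no distortion.

It remains to find, for each pair `θ ≠ τ`, such a word with `c θ ≠ c τ` (`exists_word`,
`exists_word_apply`). Modulo scalars, words form a group (`exists_mem_conjMonoid_of_mem_closure`),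
and only scalars commute projectively with all conjugates of a non-scalar isometry
(`mem_scalars_of_commutator_mem`). Commutators therefore give words that are non-scalar at `θ` but
scalar at all members not proportional to it (`exists_isolating_word`). An eigenvector of the value
at `θ` is then common to all values, which settles non-proportional pairs. For a proportional pair,
suppose that no word works. Isolating words then agree at `θ` and `τ`, and multiplying the family by
products of their conjugates makes `ψ` a common eigenvector while keeping the phase between the two
members: a contradiction.

With many qubits per pair the phase-shifted states become nearly orthonormal, and Gram–Schmidt
yields the measurement (`exists_measurement_of_tendsto`). -/

theorem inv_apply_eq_iff {C : E ≃ₗᵢ[ℂ] E} {x y : E} : C⁻¹ x = y ↔ x = C y := by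
  rw [LinearIsometryEquiv.inv_def, LinearIsometryEquiv.symm_apply_eq]

/-- The isometries that act as multiplication by a scalar. -/
def scalars (E : Type*) [NormedAddCommGroup E] [InnerProductSpace ℂ E] :
    Subgroup (E ≃ₗᵢ[ℂ] E) where
  carrier := {g | ∃ c : ℂ, ∀ x, g x = c • x}
  one_mem' := ⟨1, fun x => by simp⟩
  mul_mem' := by
    rintro a b ⟨c, hc⟩ ⟨d, hd⟩
    exact ⟨c * d, fun x => by simp [hc, hd, mul_smul]⟩
  inv_mem' := by
    rintro a ⟨c, hc⟩
    refine ⟨c⁻¹, fun x => ?_⟩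
    rw [inv_apply_eq_iff, map_smul, hc, smul_smul]
    -- The scalar is not required to be unimodular; `c = 0` occurs exactly when the space is
    -- trivial.
    by_cases h : c = 0
    · have := hc x
      rw [h, zero_smul, map_eq_zero_iff _ a.injective] at this
      simp [this]
    · rw [inv_mul_cancel₀ h, one_smul]

theorem scalars_le_center : scalars E ≤ Subgroup.center (E ≃ₗᵢ[ℂ] E) := by
  rintro g ⟨c, hc⟩
  rw [Subgroup.mem_center_iff]
  intro h
  ext x
  simp [hc]

theorem eq_smul_of_orthonormalBasis {ι : Type*} [Fintype ι] (b : OrthonormalBasis ι ℂ E)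
    {A : E ≃ₗᵢ[ℂ] E} {c : ℂ} (h : ∀ i, A (b i) = c • b i) (x : E) : A x = c • x := by
  have : A.toLinearEquiv.toLinearMap = c • LinearMap.id :=
    b.toBasis.ext fun i => by simpa using h i
  exact congrArg (fun f : E →ₗ[ℂ] E => f x) this

variable [FiniteDimensional ℂ E]

theorem exists_isometry_of_orthonormal {ι : Type*} {f g : ι → E} (hf : Orthonormal ℂ f)
    (hg : Orthonormal ℂ g) : ∃ C : E ≃ₗᵢ[ℂ] E, ∀ i, C (f i) = g i := by
  let b := Basis.span hf.linearIndependent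
  have hb : ∀ i, ((b i : Submodule.span ℂ (Set.range f)) : E) = f i := fun i => by
    simp [b, Basis.span_apply]
  have hbo : Orthonormal ℂ b := by
    refine ((Submodule.span ℂ (Set.range f)).subtypeₗᵢ.orthonormal_comp_iff).mp ?_
    convert hf using 1
    ext i; exact hb i
  let L := LinearMap.isometryOfOrthonormal (b.constr ℂ g) hbo (by
    convert hg using 1
    ext i; simp)
  refine ⟨L.extend.toLinearIsometryEquiv rfl, fun i => ?_⟩
  rw [LinearIsometry.coe_toLinearIsometryEquiv, ← hb i, LinearIsometry.extend_apply]
  simp [L]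

theorem exists_isometry_apply_eq {x y : E} (hx : ‖x‖ = 1) (hy : ‖y‖ = 1) :
    ∃ C : E ≃ₗᵢ[ℂ] E, C x = y := by
  obtain ⟨C, hC⟩ := exists_isometry_of_orthonormal (ι := Unit) (f := fun _ => x) (g := fun _ => y)
    ⟨fun _ => hx, fun i j h => (h rfl).elim⟩ ⟨fun _ => hy, fun i j h => (h rfl).elim⟩
  exact ⟨C, hC ()⟩

/-- Orthogonalising both pairs uses the same coefficient `a` and leaves remainders of the same norm
`r`, so the pairs degenerate together and otherwise reduce to orthonormal pairs. -/
theorem exists_isometry_pair_of_inner_eq {v w y z : E} (hv : ‖v‖ = 1) (hw : ‖w‖ = 1)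
    (hy : ‖y‖ = 1) (hz : ‖z‖ = 1) (h : inner ℂ v w = inner ℂ y z) :
    ∃ C : E ≃ₗᵢ[ℂ] E, C y = v ∧ C z = w := by
  set a : ℂ := inner ℂ v w with ha
  have key : ∀ {v w : E}, ‖v‖ = 1 → ‖w‖ = 1 → inner ℂ v w = a →
      inner ℂ v (w - a • v) = 0 ∧ ‖w - a • v‖ ^ 2 = 1 - ‖a‖ ^ 2 := by
    intro v w hv hw h
    have h0 : inner ℂ v (w - a • v) = 0 := by
      rw [inner_sub_right, inner_smul_right, h, inner_self_eq_norm_sq_to_K, hv]; simp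
    refine ⟨h0, ?_⟩
    have := norm_add_sq_eq_norm_sq_add_norm_sq_of_inner_eq_zero (a • v) (w - a • v)
      (by rw [inner_smul_left, h0, mul_zero])
    rw [add_sub_cancel, hw, norm_smul, hv] at this
    nlinarith
  obtain ⟨h1, n1⟩ := key hv hw rfl
  obtain ⟨h2, n2⟩ := key hy hz h.symm
  set r := ‖w - a • v‖ with hr
  have hr2 : ‖z - a • y‖ = r := by
    rw [← sq_eq_sq₀ (norm_nonneg _) (norm_nonneg _), n1, n2]
  by_cases hr0 : r = 0
  · obtain ⟨C, hC⟩ := exists_isometry_apply_eq hy hv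
    refine ⟨C, hC, ?_⟩
    rw [hr0, norm_eq_zero, sub_eq_zero] at hr2
    rw [hr0, eq_comm, norm_eq_zero, sub_eq_zero] at hr
    rw [hr2, hr, map_smul, hC]
  · have hon : ∀ {v w : E}, ‖v‖ = 1 → inner ℂ v (w - a • v) = 0 → ‖w - a • v‖ = r →
        Orthonormal ℂ ![v, (r⁻¹ : ℂ) • (w - a • v)] := by
      intro v w hv h0 hr
      rw [orthonormal_iff_ite]
      have hvv : inner ℂ v v = 1 := by rw [inner_self_eq_norm_sq_to_K, hv]; simp
      have hww : inner ℂ ((r⁻¹ : ℂ) • (w - a • v)) ((r⁻¹ : ℂ) • (w - a • v)) = 1 := by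
        rw [inner_self_eq_norm_sq_to_K, norm_smul, hr]
        simp [abs_of_nonneg (hr ▸ norm_nonneg (w - a • v) : 0 ≤ r), hr0]
      have h0' : inner ℂ (w - a • v) v = 0 := inner_eq_zero_symm.mp h0
      intro i j
      fin_cases i <;> fin_cases j
      · simpa using hvv
      · simp [inner_smul_right, h0]
      · simp [inner_smul_left, h0']
      · simpa using hww
    obtain ⟨C, hC⟩ := exists_isometry_of_orthonormal (hon hy h2 hr2) (hon hv h1 rfl)
    have hC0 : C y = v := hC 0
    have hC1 : C ((r⁻¹ : ℂ) • (z - a • y)) = (r⁻¹ : ℂ) • (w - a • v) := hC 1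
    refine ⟨C, hC0, ?_⟩
    rw [map_smul] at hC1
    have := smul_right_injective E (inv_ne_zero (Complex.ofReal_ne_zero.mpr hr0)) hC1
    rw [map_sub, map_smul, hC0] at this
    exact sub_left_injective this

theorem exists_isometry_pair {v w y z : E} (hv : ‖v‖ = 1) (hw : ‖w‖ = 1)
    (hy : ‖y‖ = 1) (hz : ‖z‖ = 1) (h : ‖inner ℂ v w‖ = ‖inner ℂ y z‖) :
    ∃ C : E ≃ₗᵢ[ℂ] E, ∃ c : ℂ, ‖c‖ = 1 ∧ C y = v ∧ C z = c • w := by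
  obtain ⟨c, hc, hcw⟩ : ∃ c : ℂ, ‖c‖ = 1 ∧ inner ℂ v (c • w) = inner ℂ y z := by
    by_cases h0 : inner ℂ v w = 0
    · refine ⟨1, by simp, ?_⟩
      rw [h0, norm_zero, eq_comm, norm_eq_zero] at h
      rw [one_smul, h0, h]
    · refine ⟨inner ℂ y z / inner ℂ v w, ?_, ?_⟩
      · rw [norm_div, h, div_self]
        rwa [← h, norm_ne_zero_iff]
      · rw [inner_smul_right, div_mul_cancel₀ _ h0]
  obtain ⟨C, h1, h2⟩ := exists_isometry_pair_of_inner_eq hv (w := c • w)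
    (by rw [norm_smul, hc, hw, one_mul]) hy hz hcw
  exact ⟨C, c, hc, h1, h2⟩

/-- Eigenvalues are unimodular, so preservation of the inner product makes eigenspaces orthogonal
and the complement of their sum invariant; an eigenvector in that complement would be a
contradiction. -/
theorem exists_orthonormalBasis_eigenvectors (A : E ≃ₗᵢ[ℂ] E) :
    ∃ (b : OrthonormalBasis (Fin (finrank ℂ E)) ℂ E) (d : Fin (finrank ℂ E) → ℂ),
      ∀ i, A (b i) = d i • b i := by
  let T : End ℂ E := A.toLinearEquiv.toLinearMap
  have hT : ∀ x, T x = A x := fun _ => rfl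
  have hunit : ∀ {μ : ℂ} {v : E}, A v = μ • v → v ≠ 0 → starRingEnd ℂ μ * μ = 1 := by
    intro μ v hv h0
    have h1 : inner ℂ (A v) (A v) = inner ℂ v v := A.inner_map_map v v
    rw [hv, inner_smul_left, inner_smul_right, ← mul_assoc] at h1
    exact mul_right_cancel₀ (inner_self_ne_zero.mpr h0) (h1.trans (one_mul _).symm)
  have hfam : OrthogonalFamily ℂ (fun μ : Eigenvalues T => eigenspace T μ)
      fun μ => (eigenspace T μ).subtypeₗᵢ := by
    rintro ⟨μ, hμ⟩ ⟨ν, hν⟩ hne ⟨v, hv⟩ ⟨w, hw⟩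
    rw [mem_eigenspace_iff, hT] at hv hw
    change inner ℂ v w = 0
    by_cases hv0 : v = 0
    · simp [hv0]
    by_contra h0
    have h1 : inner ℂ (A v) (A w) = inner ℂ v w := A.inner_map_map v w
    change A v = μ • v at hv
    change A w = ν • w at hw
    rw [hv, hw, inner_smul_left, inner_smul_right, ← mul_assoc] at h1
    have h2 : starRingEnd ℂ μ * ν = 1 := mul_right_cancel₀ h0 (h1.trans (one_mul _).symm)
    have h3 := hunit hv hv0
    apply hne
    refine Subtype.ext ?_
    exact mul_left_cancel₀ (left_ne_zero_of_mul_eq_one h3) (h3.trans h2.symm)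
  have hbot : (⨆ μ : Eigenvalues T, eigenspace T μ)ᗮ = ⊥ := by
    change (⨆ μ : { μ // eigenspace T μ ≠ ⊥ }, eigenspace T μ)ᗮ = ⊥
    rw [iSup_ne_bot_subtype]
    have hinv : ∀ v ∈ (⨆ μ, eigenspace T μ)ᗮ, T v ∈ (⨆ μ, eigenspace T μ)ᗮ := by
      intro v hv
      rw [← Submodule.iInf_orthogonal, Submodule.mem_iInf] at hv ⊢
      intro μ
      rw [Submodule.mem_orthogonal]
      intro w hw
      rw [mem_eigenspace_iff, hT] at hw
      by_cases hw0 : w = 0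
      · simp [hw0]
      have h1 : inner ℂ (A w) (A v) = inner ℂ w v := A.inner_map_map w v
      rw [(Submodule.mem_orthogonal _ _).mp (hv μ) w (mem_eigenspace_iff.mpr hw), hw,
        inner_smul_left] at h1
      exact (mul_eq_zero.mp h1).resolve_left (left_ne_zero_of_mul_eq_one (hunit hw hw0))
    by_contra hne
    have : Nontrivial ↥(⨆ μ, eigenspace T μ)ᗮ := Submodule.nontrivial_iff_ne_bot.mpr hne
    obtain ⟨μ, hμ⟩ := exists_eigenvalue (T.restrict hinv)
    have hd : Disjoint (eigenspace T μ) (⨆ μ, eigenspace T μ)ᗮ :=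
      ((Submodule.isOrtho_orthogonal_right _).mono_left (le_iSup _ _)).disjoint
    exact hμ (eigenspace_restrict_eq_bot hinv hd)
  classical
  have hint := hfam.isInternal_iff.mpr hbot
  refine ⟨hint.subordinateOrthonormalBasis rfl hfam,
    fun i => ((hint.subordinateOrthonormalBasisIndex rfl i hfam : Eigenvalues T) : ℂ), fun i => ?_⟩
  exact mem_eigenspace_iff.mp (hint.subordinateOrthonormalBasis_subordinate rfl i hfam)

theorem exists_eigenvectors_of_notMem_scalars {A : E ≃ₗᵢ[ℂ] E} (hA : A ∉ scalars E) :
    ∃ (x y : E) (a b : ℂ), ‖x‖ = 1 ∧ ‖y‖ = 1 ∧ A x = a • x ∧ A y = b • y ∧ a ≠ b := by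
  obtain ⟨b, d, hd⟩ := exists_orthonormalBasis_eigenvectors A
  by_contra! H
  have hconst : ∀ i j, d i = d j := fun i j =>
    H (b i) (b j) (d i) (d j) (b.norm_eq_one i) (b.norm_eq_one j) (hd i) (hd j)
  refine hA ?_
  rcases isEmpty_or_nonempty (Fin (finrank ℂ E)) with h | ⟨⟨i⟩⟩
  · exact ⟨0, eq_smul_of_orthonormalBasis b fun i => isEmptyElim i⟩
  · exact ⟨d i, eq_smul_of_orthonormalBasis b fun j => by rw [hd, hconst j i]⟩

/-- Otherwise Cauchy–Schwarz is an equality for every `v` and `A v`, so every vector is an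
eigenvector. -/
theorem exists_norm_inner_lt_one {A : E ≃ₗᵢ[ℂ] E} (hA : A ∉ scalars E) :
    ∃ v, ‖v‖ = 1 ∧ ‖inner ℂ v (A v)‖ < 1 := by
  by_contra! H
  refine hA ?_
  have key : ∀ v, ¬ LinearIndependent ℂ ![v, A.toLinearEquiv.toLinearMap v] := by
    intro v hli
    have hv0 : v ≠ 0 := hli.ne_zero 0
    have hnv : (‖v‖ : ℂ) ≠ 0 := by simpa using hv0
    have h1 : ‖(‖v‖⁻¹ : ℂ) • v‖ = 1 := by
      rw [norm_smul, norm_inv, Complex.norm_real, norm_norm, inv_mul_cancel₀ (by simpa using hv0)]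
    have h2 := H _ h1
    rw [map_smul, inner_smul_left, inner_smul_right, norm_mul, norm_mul] at h2
    have h3 : ‖inner ℂ v (A v)‖ = ‖v‖ * ‖A v‖ := by
      refine le_antisymm (norm_inner_le_norm _ _) ?_
      rw [A.norm_map]
      have hp : 0 < ‖v‖ := norm_pos_iff.mpr hv0
      simp only [RCLike.norm_conj, norm_inv, Complex.norm_real, norm_norm] at h2
      rw [← mul_assoc, ← mul_inv, mul_comm, ← div_eq_mul_inv, le_div_iff₀ (by positivity)] at h2
      linarith
    obtain ⟨r, -, hr⟩ := (norm_inner_eq_norm_iff hv0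
      (by rwa [Ne, map_eq_zero_iff _ A.injective])).mp h3
    have := (LinearIndependent.pair_iff.mp hli) r (-1) (by
      change r • v + (-1 : ℂ) • A v = 0
      rw [hr]; simp)
    simp at this
  obtain ⟨a, ha⟩ := LinearMap.exists_eq_smul_id_of_forall_notLinearIndependent key
  exact ⟨a, fun x => congrArg (fun f : E →ₗ[ℂ] E => f x) ha⟩

end Isometries

/-! ### Products of conjugates: action on rays, inverses, commutators -/

/-- The products of simultaneous conjugates of the members of a family in a group. -/
def conjMonoid {Θ H : Type*} [Group H] (u : Θ → H) : Submonoid (Θ → H) :=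
  Submonoid.closure (Set.range fun (C : H) θ => C⁻¹ * u θ * C)

/-- The products of conjugates of an element of a group. -/
def conjMonoid₁ {H : Type*} [Group H] (A : H) : Submonoid H :=
  Submonoid.closure (Set.range fun C : H => C⁻¹ * A * C)

section Isometries

open Module Module.End

variable {E : Type*} [NormedAddCommGroup E] [InnerProductSpace ℂ E] [FiniteDimensional ℂ E]

theorem one_lt_rank_real {x : E} (hx : ‖x‖ = 1) : 1 < Module.rank ℝ E := by
  have : Nontrivial E := ⟨x, 0, by rintro rfl; simp at hx⟩
  have h : 0 < finrank ℂ E := finrank_pos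
  rw [rank_real_of_complex, ← finrank_eq_rank]
  exact_mod_cast (by omega : 1 < 2 * finrank ℂ E)

/-- The products of conjugates of a non-scalar isometry act transitively on rays. -/
theorem exists_mem_conjMonoid₁_apply_eq {A : E ≃ₗᵢ[ℂ] E} (hA : A ∉ scalars E) {x y : E}
    (hx : ‖x‖ = 1) (hy : ‖y‖ = 1) : ∃ D ∈ conjMonoid₁ A, ∃ c : ℂ, D x = c • y := by
  obtain ⟨v, hv, hr⟩ := exists_norm_inner_lt_one hA
  obtain ⟨e, -, a, -, he, -, hae, -, -⟩ := exists_eigenvectors_of_notMem_scalars hA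
  have hS := isPreconnected_sphere (one_lt_rank_real hx) (0 : E) 1
  have he1 : ‖inner ℂ e (A e)‖ = 1 := by
    have : ‖A e‖ = 1 := by rw [A.norm_map, he]
    rw [hae, norm_smul, he, mul_one] at this
    rw [hae, inner_smul_right, inner_self_eq_norm_sq_to_K, he]
    simpa using this
  -- On the connected sphere the overlap of `w` and `A w` attains all values between that at `v` and
  -- 1. When it equals the overlap of `y` and `z`, an isometry takes `y` to `w` and `z` to a
  -- multiple of `A w`, so a single conjugate suffices.
  have hstep : ∀ y z : E, ‖y‖ = 1 → ‖z‖ = 1 → ‖inner ℂ v (A v)‖ ≤ ‖inner ℂ y z‖ →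
      ∃ D ∈ conjMonoid₁ A, ∃ c : ℂ, D y = c • z := by
    intro y z hy hz h
    have hf : ContinuousOn (fun w : E => ‖inner ℂ w (A w)‖) (Metric.sphere 0 1) :=
      (continuous_id.inner A.continuous).norm.continuousOn
    have hle : ‖inner ℂ y z‖ ≤ ‖inner ℂ e (A e)‖ := by
      rw [he1]
      simpa [hy, hz] using norm_inner_le_norm (𝕜 := ℂ) y z
    obtain ⟨w, hw, hwe⟩ := hS.intermediate_value (by simpa using hv) (by simpa using he) hf
      ⟨h, hle⟩
    have hw1 : ‖w‖ = 1 := by simpa using hw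
    obtain ⟨C, c, hc, hC1, hC2⟩ := exists_isometry_pair hw1
      (by rw [A.norm_map, hw1] : ‖A w‖ = 1) hy hz hwe
    refine ⟨C⁻¹ * A * C, Submonoid.subset_closure ⟨C, rfl⟩, c⁻¹, ?_⟩
    have hc0 : c ≠ 0 := by rintro rfl; simp at hc
    change C⁻¹ (A (C y)) = _
    rw [inv_apply_eq_iff, map_smul, hC1, hC2, smul_smul, inv_mul_cancel₀ hc0, one_smul]
  -- Nearby unit vectors have overlap close to 1; connectedness chains such steps.
  refine hS.induction₂' (fun x y => ∃ D ∈ conjMonoid₁ A, ∃ c : ℂ, D x = c • y) ?_ ?_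
    (by simpa using hx) (by simpa using hy)
  · intro x hx
    have hx1 : ‖x‖ = 1 := by simpa using hx
    have hcont : ContinuousAt (fun y : E => ‖inner ℂ x y‖) x :=
      (continuous_const.inner continuous_id).norm.continuousAt
    have hlt : ‖inner ℂ v (A v)‖ < ‖inner ℂ x x‖ := by
      rw [inner_self_eq_norm_sq_to_K, hx1]; simpa using hr
    filter_upwards [nhdsWithin_le_nhds (hcont.eventually (lt_mem_nhds hlt)),
      self_mem_nhdsWithin] with y hy hy1
    have hy1 : ‖y‖ = 1 := by simpa using hy1
    exact ⟨hstep x y hx1 hy1 hy.le, hstep y x hy1 hx1 ((norm_inner_symm (𝕜 := ℂ) x y) ▸ hy.le)⟩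
  · rintro x y z - - - ⟨D, hD, c, hc⟩ ⟨D', hD', c', hc'⟩
    refine ⟨D' * D, mul_mem hD' hD, c * c', ?_⟩
    change D' (D x) = _
    rw [hc, map_smul, hc', smul_smul]

/-- An isometry has an inverse up to scalars among the products of its conjugates. -/
theorem exists_mem_conjMonoid₁_mul_mem_scalars (A : E ≃ₗᵢ[ℂ] E) :
    ∃ D ∈ conjMonoid₁ A, D * A ∈ scalars E := by
  obtain ⟨b, d, hd⟩ := exists_orthonormalBasis_eigenvectors A
  let C : Equiv.Perm (Fin (finrank ℂ E)) → (E ≃ₗᵢ[ℂ] E) := fun π => b.equiv b π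
  have hC : ∀ π i, (C π)⁻¹ (A (C π (b i))) = d (π i) • b i := by
    intro π i
    rw [inv_apply_eq_iff, map_smul, OrthonormalBasis.equiv_apply_basis, hd]
  have hprod : ∀ (l : List (Equiv.Perm (Fin (finrank ℂ E)))) i,
      (l.map fun π => (C π)⁻¹ * A * C π).prod (b i) = (l.map fun π => d (π i)).prod • b i := by
    intro l i
    induction l with
    | nil => simp
    | cons π l ih =>
      rw [List.map_cons, List.prod_cons, LinearIsometryEquiv.coe_mul, Function.comp_apply, ih,
        map_smul, List.map_cons, List.prod_cons, mul_comm, mul_smul]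
      exact congrArg _ (hC π i)
  -- The conjugates of `A` by all permutations of an eigenbasis multiply to a scalar; the identity
  -- contributes `A`, so the others invert it.
  refine ⟨_, Submonoid.list_prod_mem _ (l := ((Finset.univ.erase 1).toList.map
    fun π => (C π)⁻¹ * A * C π)) ?_, ?_⟩
  · intro x hx
    obtain ⟨π, -, rfl⟩ := List.mem_map.mp hx
    exact Submonoid.subset_closure ⟨C π, rfl⟩
  · have hval : ∀ i, ((((Finset.univ.erase 1).toList.map fun π => (C π)⁻¹ * A * C π).prod * A :
        E ≃ₗᵢ[ℂ] E)) (b i) = (∏ π : Equiv.Perm (Fin (finrank ℂ E)), d (π i)) • b i := by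
      intro i
      rw [LinearIsometryEquiv.coe_mul, Function.comp_apply, hd, map_smul, hprod, smul_smul,
        Finset.prod_map_toList, ← Finset.mul_prod_erase _ _ (Finset.mem_univ 1)]
      rfl
    have hconst : ∀ i j, (∏ π : Equiv.Perm (Fin (finrank ℂ E)), d (π i)) =
        ∏ π : Equiv.Perm (Fin (finrank ℂ E)), d (π j) := by
      intro i j
      rw [← Equiv.prod_comp (Equiv.mulRight (Equiv.swap i j))]
      simp
    rcases isEmpty_or_nonempty (Fin (finrank ℂ E)) with h | ⟨⟨i⟩⟩
    · exact ⟨0, eq_smul_of_orthonormalBasis b fun i => isEmptyElim i⟩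
    · exact ⟨_, eq_smul_of_orthonormalBasis b fun j => by rw [hval, hconst j i]⟩

/-- An isometry that commutes up to scalars with all conjugates of a non-scalar isometry is
scalar. -/
theorem mem_scalars_of_commutator_mem {A k : E ≃ₗᵢ[ℂ] E} (hA : A ∉ scalars E)
    (h : ∀ C, k * (C⁻¹ * A * C) * k⁻¹ * (C⁻¹ * A * C)⁻¹ ∈ scalars E) : k ∈ scalars E := by
  by_contra hk
  have hcomm : ∀ D ∈ conjMonoid₁ A, ∃ c : ℂ, ∀ x, k (D x) = c • D (k x) := by
    intro D hD
    induction hD using Submonoid.closure_induction with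
    | mem D hD =>
      obtain ⟨C, rfl⟩ := hD
      obtain ⟨c, hc⟩ := h C
      refine ⟨c, fun x => ?_⟩
      rw [← hc]
      beta_reduce
      generalize C⁻¹ * A * C = B
      exact congrArg (fun g : E ≃ₗᵢ[ℂ] E => g x)
        (by group : k * B = k * B * k⁻¹ * B⁻¹ * B * k)
    | one => exact ⟨1, fun x => by simp⟩
    | mul D D' _ _ h h' =>
      obtain ⟨c, hc⟩ := h
      obtain ⟨c', hc'⟩ := h'
      refine ⟨c * c', fun x => ?_⟩
      change k (D (D' x)) = (c * c') • D (D' (k x))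
      rw [hc, hc', map_smul, smul_smul]
  -- Some `D` carries an eigenvector `e` of `k` to the ray of `v`. As `k` commutes with `D` up to a
  -- phase, `v` is an eigenvector too, against its choice.
  obtain ⟨v, hv, hlt⟩ := exists_norm_inner_lt_one hk
  obtain ⟨e, -, a, -, he, -, hae, -, -⟩ := exists_eigenvectors_of_notMem_scalars hk
  obtain ⟨D, hD, c, hc⟩ := exists_mem_conjMonoid₁_apply_eq hA he hv
  obtain ⟨c', hc'⟩ := hcomm D hD
  have h1 := hc' e
  have hc0 : c ≠ 0 := by
    rintro rfl
    rw [zero_smul, map_eq_zero_iff _ D.injective] at hc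
    simp [hc] at he
  rw [hae, map_smul, hc, map_smul, smul_comm a c v, smul_comm c' c] at h1
  have h2 := smul_right_injective E hc0 h1
  have h3 : ‖k v‖ = 1 := by rw [k.norm_map, hv]
  simp only [smul_smul] at h2
  rw [h2, norm_smul, hv, mul_one] at h3
  rw [h2, inner_smul_right, inner_self_eq_norm_sq_to_K, hv, norm_mul, h3] at hlt
  simp at hlt

end Isometries

/-! ### Words in a group modulo a central subgroup -/

section Groups

variable {Θ H : Type*} [Group H]

theorem conj_mem_conjMonoid {u w : Θ → H} (hw : w ∈ conjMonoid u) (C : H) :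
    (fun θ => C⁻¹ * w θ * C) ∈ conjMonoid u := by
  induction hw using Submonoid.closure_induction with
  | mem w hw =>
    obtain ⟨D, rfl⟩ := hw
    refine Submonoid.subset_closure ⟨D * C, ?_⟩
    ext θ
    group
  | one => convert (conjMonoid u).one_mem using 1; ext θ; simp
  | mul w w' _ _ h h' =>
    convert mul_mem h h' using 1
    ext θ
    simp only [Pi.mul_apply]
    group

theorem self_mem_conjMonoid (u : Θ → H) : u ∈ conjMonoid u :=
  Submonoid.subset_closure ⟨1, by simp⟩

theorem conjMonoid_le {u : Θ → H} {S : Submonoid (Θ → H)}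
    (hu : ∀ C, (fun θ => C⁻¹ * u θ * C) ∈ S) : conjMonoid u ≤ S :=
  Submonoid.closure_le.mpr (Set.range_subset_iff.mpr hu)

theorem conjMonoid_mono {u w : Θ → H} (hw : w ∈ conjMonoid u) : conjMonoid w ≤ conjMonoid u :=
  conjMonoid_le fun C => conj_mem_conjMonoid hw C

/-- The same conjugators, used at all parameters, extend a word at `σ` to the whole family. -/
theorem exists_mem_conjMonoid_apply {w : Θ → H} {σ : Θ} {D : H} (hD : D ∈ conjMonoid₁ (w σ)) :
    ∃ t ∈ conjMonoid w, t σ = D := by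
  have h : (conjMonoid w).map (Pi.evalMonoidHom (fun _ => H) σ) = conjMonoid₁ (w σ) := by
    rw [conjMonoid, MonoidHom.map_mclosure, conjMonoid₁, ← Set.range_comp]
    rfl
  rw [← h] at hD
  exact hD

variable {Z : Subgroup H} (hZ : Z ≤ Subgroup.center H)

include hZ

theorem conj_mem_of_le_center {z : H} (hz : z ∈ Z) (C : H) : C⁻¹ * z * C ∈ Z := by
  rw [mul_assoc, ← Subgroup.mem_center_iff.mp (hZ hz) C, inv_mul_cancel_left]
  exact hz

theorem apply_mem_of_mem_conjMonoid {u w : Θ → H} (hw : w ∈ conjMonoid u) {σ : Θ}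
    (hσ : u σ ∈ Z) : w σ ∈ Z := by
  refine conjMonoid_le (S := Z.toSubmonoid.comap (Pi.evalMonoidHom (fun _ => H) σ)) ?_ hw
  exact fun C => conj_mem_of_le_center hZ hσ C

/-- Each conjugate contributes one central factor `z`, so `m` is the number of factors of the word.
-/
theorem exists_eq_mul_of_mem_conjMonoid {u w : Θ → H} (hw : w ∈ conjMonoid u) {θ τ : Θ} {z : H}
    (hz : z ∈ Z) (h : u τ = z * u θ) : ∃ m : ℕ, w τ = z ^ m * w θ := by
  have hc := Subgroup.mem_center_iff.mp (hZ hz)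
  induction hw using Submonoid.closure_induction with
  | mem w hw =>
    obtain ⟨C, rfl⟩ := hw
    refine ⟨1, ?_⟩
    simp only [h, pow_one, ← mul_assoc]
    rw [hc C⁻¹]
  | one => exact ⟨0, by simp⟩
  | mul w w' _ _ h h' =>
    obtain ⟨m, hm⟩ := h
    obtain ⟨m', hm'⟩ := h'
    refine ⟨m + m', ?_⟩
    have hcm : ∀ g, g * z ^ m' = z ^ m' * g :=
      Subgroup.mem_center_iff.mp (pow_mem (hZ hz) m')
    rw [Pi.mul_apply, hm, hm', Pi.mul_apply, pow_add, mul_assoc, ← mul_assoc (w θ), hcm]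
    simp only [mul_assoc]

/-- Parameters are treated one at a time: a word in conjugates of `r * w` inverts it at `σ` and
stays in `Z` wherever `r * w` already is. -/
theorem exists_mul_mem_of_mem_conjMonoid [Fintype Θ]
    (hinv : ∀ A : H, ∃ D ∈ conjMonoid₁ A, D * A ∈ Z) {u w : Θ → H} (hw : w ∈ conjMonoid u) :
    ∃ r ∈ conjMonoid u, ∀ θ, r θ * w θ ∈ Z := by
  classical
  suffices h : ∀ S : Finset Θ, ∃ r ∈ conjMonoid u, ∀ θ ∈ S, r θ * w θ ∈ Z by
    obtain ⟨r, hr, h⟩ := h Finset.univ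
    exact ⟨r, hr, fun θ => h θ (Finset.mem_univ θ)⟩
  intro S
  induction S using Finset.induction_on with
  | empty => exact ⟨1, one_mem _, by simp⟩
  | insert σ S _ ih =>
    obtain ⟨r, hr, hS⟩ := ih
    obtain ⟨D, hD, hDσ⟩ := hinv ((r * w) σ)
    obtain ⟨t, ht, rfl⟩ := exists_mem_conjMonoid_apply hD
    refine ⟨t * r, mul_mem (conjMonoid_mono (mul_mem hr hw) ht) hr, fun θ hθ => ?_⟩
    rw [Pi.mul_apply, mul_assoc]
    rcases Finset.mem_insert.mp hθ with rfl | hθ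
    · exact hDσ
    · exact mul_mem (apply_mem_of_mem_conjMonoid hZ ht (hS θ hθ)) (hS θ hθ)

/-- Up to members of `Z`, the products of simultaneous conjugates of a family form a group. -/
theorem exists_mem_conjMonoid_of_mem_closure [Fintype Θ]
    (hinv : ∀ A : H, ∃ D ∈ conjMonoid₁ A, D * A ∈ Z) {u g : Θ → H}
    (hg : g ∈ Subgroup.closure (Set.range fun (C : H) θ => C⁻¹ * u θ * C)) :
    ∃ w ∈ conjMonoid u, ∀ θ, w θ * (g θ)⁻¹ ∈ Z := by
  have hc : ∀ {z : H}, z ∈ Z → ∀ g, g * z = z * g := fun hz =>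
    Subgroup.mem_center_iff.mp (hZ hz)
  induction hg using Subgroup.closure_induction with
  | mem g hg => exact ⟨g, Submonoid.subset_closure hg, fun θ => by simp⟩
  | one => exact ⟨1, one_mem _, fun θ => by simp⟩
  | mul g g' _ _ h h' =>
    obtain ⟨w, hw, h⟩ := h
    obtain ⟨w', hw', h'⟩ := h'
    refine ⟨w * w', mul_mem hw hw', fun θ => ?_⟩
    have : (w * w') θ * ((g * g') θ)⁻¹ = w' θ * (g' θ)⁻¹ * (w θ * (g θ)⁻¹) := by
      rw [← mul_assoc, ← hc (h' θ)]
      simp [mul_assoc]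
    rw [this]
    exact mul_mem (h' θ) (h θ)
  | inv g _ h =>
    obtain ⟨w, hw, h⟩ := h
    obtain ⟨r, hr, hrw⟩ := exists_mul_mem_of_mem_conjMonoid hZ hinv hw
    refine ⟨r, hr, fun θ => ?_⟩
    have : r θ * (g⁻¹ θ)⁻¹ = r θ * w θ * ((g θ)⁻¹ * (w θ * (g θ)⁻¹)⁻¹ * g θ) := by
      rw [Pi.inv_apply]
      group
    rw [this]
    exact mul_mem (hrw θ) (conj_mem_of_le_center hZ (inv_mem (h θ)) _)

theorem exists_separating {Θ : Type*}
    (hkey : ∀ A k : H, A ∉ Z → (∀ C, k * (C⁻¹ * A * C) * k⁻¹ * (C⁻¹ * A * C)⁻¹ ∈ Z) → k ∈ Z)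
    {u : Θ → H} {θ τ : Θ}
    (hθ : u θ ∉ Z) (hθτ : u θ * (u τ)⁻¹ ∉ Z) :
    ∃ g ∈ Subgroup.closure (Set.range fun (C : H) θ => C⁻¹ * u θ * C), g τ ∈ Z ∧ g θ ∉ Z := by
  by_contra! h
  refine hθτ (hkey (u θ) _ hθ fun C => ?_)
  have hu : u ∈ Subgroup.closure (Set.range fun (C : H) θ => C⁻¹ * u θ * C) :=
    Subgroup.subset_closure ⟨1, by simp⟩
  have hg : ∀ C : H, (fun θ => C⁻¹ * u θ * C) ∈
      Subgroup.closure (Set.range fun (C : H) θ => C⁻¹ * u θ * C) := fun C =>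
    Subgroup.subset_closure ⟨C, rfl⟩
  -- This element is trivial at `τ`, because there conjugation by `C * u τ` undoes the first three
  -- factors. At `θ` it is conjugate to the inverse of the commutator of `u θ * (u τ)⁻¹` with `C⁻¹ *
  -- u θ * C`.
  have h1 := h _ (mul_mem (mul_mem (mul_mem (inv_mem hu) (hg C)) hu) (inv_mem (hg (C * u τ))))
    (by convert Z.one_mem using 1; simp [mul_assoc])
  have h2 := inv_mem (conj_mem_of_le_center hZ h1 (u θ)⁻¹)
  convert h2 using 1
  simp [mul_assoc]

/-- A commutator lies in `Z` wherever one of its entries does. So an element central on `S` and one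
central at `σ` combine to one central on both, and `hkey` supplies a conjugate that keeps it
non-central at `θ`. -/
theorem exists_isolating {Θ : Type*}
    (hkey : ∀ A k : H, A ∉ Z → (∀ C, k * (C⁻¹ * A * C) * k⁻¹ * (C⁻¹ * A * C)⁻¹ ∈ Z) → k ∈ Z)
    {u : Θ → H} {θ : Θ}
    (hθ : u θ ∉ Z) (S : Finset Θ) (hS : ∀ τ ∈ S, u θ * (u τ)⁻¹ ∉ Z) :
    ∃ g ∈ Subgroup.closure (Set.range fun (C : H) θ => C⁻¹ * u θ * C),
      g θ ∉ Z ∧ ∀ τ ∈ S, g τ ∈ Z := by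
  classical
  have hc : ∀ {z : H}, z ∈ Z → ∀ g, g * z = z * g := fun hz =>
    Subgroup.mem_center_iff.mp (hZ hz)
  induction S using Finset.induction_on with
  | empty => exact ⟨u, Subgroup.subset_closure ⟨1, by simp⟩, hθ, by simp⟩
  | insert σ S _ ih =>
    obtain ⟨g, hg, hgθ, hgS⟩ := ih fun τ hτ => hS τ (Finset.mem_insert_of_mem hτ)
    obtain ⟨h, hh, hhσ, hhθ⟩ := exists_separating hZ hkey hθ (hS σ (Finset.mem_insert_self _ _))
    obtain ⟨C, hC⟩ : ∃ C, g θ * (C⁻¹ * h θ * C) * (g θ)⁻¹ * (C⁻¹ * h θ * C)⁻¹ ∉ Z := by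
      by_contra! H
      exact hgθ (hkey _ _ hhθ H)
    have hconj : (fun θ => C⁻¹ * h θ * C) ∈
        Subgroup.closure (Set.range fun (C : H) θ => C⁻¹ * u θ * C) := by
      clear hhσ hhθ hC
      induction hh using Subgroup.closure_induction with
      | mem g hg =>
        obtain ⟨D, rfl⟩ := hg
        exact Subgroup.subset_closure ⟨D * C, by ext θ; simp [mul_assoc]⟩
      | one =>
        convert (Subgroup.closure (Set.range fun (C : H) θ => C⁻¹ * u θ * C)).one_mem using 1
        ext θ
        simp
      | mul a b _ _ ha hb => convert mul_mem ha hb using 1; ext θ; simp [mul_assoc]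
      | inv a _ ha => convert inv_mem ha using 1; ext θ; simp [mul_assoc]
    refine ⟨g * (fun θ => C⁻¹ * h θ * C) * g⁻¹ * (fun θ => C⁻¹ * h θ * C)⁻¹,
      mul_mem (mul_mem (mul_mem hg hconj) (inv_mem hg)) (inv_mem hconj), hC, fun τ hτ => ?_⟩
    convert Z.one_mem using 1
    rcases Finset.mem_insert.mp hτ with rfl | hτ
    · simp only [Pi.mul_apply, Pi.inv_apply]
      rw [hc (conj_mem_of_le_center hZ hhσ C) (g τ)]
      simp
    · simp only [Pi.mul_apply, Pi.inv_apply]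
      rw [← hc (hgS τ hτ)]
      simp

end Groups

/-! ### Words with a common eigenvector that separate two members -/

section Words

variable {E : Type*} [NormedAddCommGroup E] [InnerProductSpace ℂ E]
  {Θ : Type*}

/-- An eigenvector of an isolating word is a common eigenvector of all its values. -/
theorem exists_smul_of_isolating {u s : Θ → (E ≃ₗᵢ[ℂ] E)} {θ : Θ} (hs : s ∈ conjMonoid u)
    (h : ∀ τ, u θ * (u τ)⁻¹ ∉ scalars E → s τ ∈ scalars E) {x : E} {a : ℂ} (hx : s θ x = a • x)
    (τ : Θ) : ∃ c : ℂ, s τ x = c • x := by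
  by_cases hτ : u θ * (u τ)⁻¹ ∈ scalars E
  · obtain ⟨m, hm⟩ := exists_eq_mul_of_mem_conjMonoid scalars_le_center hs (θ := θ) (τ := τ)
      (inv_mem hτ) (by simp)
    obtain ⟨c, hc⟩ := pow_mem (inv_mem hτ) m
    refine ⟨c * a, ?_⟩
    rw [hm, LinearIsometryEquiv.coe_mul, Function.comp_apply, hx, hc, smul_smul]
  · obtain ⟨c, hc⟩ := h τ hτ
    exact ⟨c, hc x⟩

variable [FiniteDimensional ℂ E] [Fintype Θ]

/-- Up to phases, a word can be non-scalar at one member of the family and at those that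
differ from it by a phase only. -/
theorem exists_isolating_word {u : Θ → (E ≃ₗᵢ[ℂ] E)} {θ : Θ} (hθ : u θ ∉ scalars E) :
    ∃ s ∈ conjMonoid u, s θ ∉ scalars E ∧
      ∀ τ, u θ * (u τ)⁻¹ ∉ scalars E → s τ ∈ scalars E := by
  classical
  obtain ⟨g, hg, hgθ, hgS⟩ := exists_isolating scalars_le_center
    (fun A k hA h => mem_scalars_of_commutator_mem hA h) hθ
    (Finset.univ.filter fun τ => u θ * (u τ)⁻¹ ∉ scalars E) (by simp)
  obtain ⟨w, hw, h⟩ := exists_mem_conjMonoid_of_mem_closure scalars_le_center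
    exists_mem_conjMonoid₁_mul_mem_scalars hg
  refine ⟨w, hw, fun hwθ => hgθ ?_, fun τ hτ => ?_⟩
  · have := mul_mem (inv_mem (h θ)) hwθ
    rw [mul_inv_rev, inv_inv, inv_mul_cancel_right] at this
    exact this
  · have := mul_mem (h τ) (hgS τ (by simpa using hτ))
    rwa [inv_mul_cancel_right] at this

theorem exists_word_of_notMem {u : Θ → (E ≃ₗᵢ[ℂ] E)} {θ τ : Θ} (hθ : u θ ∉ scalars E)
    (hθτ : u θ * (u τ)⁻¹ ∉ scalars E) :
    ∃ w ∈ conjMonoid u, ∃ (x : E) (c : Θ → ℂ), ‖x‖ = 1 ∧ (∀ σ, w σ x = c σ • x) ∧ c θ ≠ c τ := by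
  obtain ⟨s, hs, hsθ, hsc⟩ := exists_isolating_word hθ
  obtain ⟨x, y, a, b, hx, hy, hax, hby, hab⟩ := exists_eigenvectors_of_notMem_scalars hsθ
  obtain ⟨e, he⟩ := hsc τ hθτ
  have key : ∀ (x : E) (a : ℂ), ‖x‖ = 1 → s θ x = a • x → a ≠ e →
      ∃ w ∈ conjMonoid u, ∃ (x : E) (c : Θ → ℂ), ‖x‖ = 1 ∧ (∀ σ, w σ x = c σ • x) ∧
        c θ ≠ c τ := by
    intro x a hx hax hae
    choose c hc using exists_smul_of_isolating hs hsc hax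
    have hx0 : x ≠ 0 := by rintro rfl; simp at hx
    refine ⟨s, hs, x, c, hx, hc, ?_⟩
    have h1 : c θ = a := smul_left_injective ℂ hx0 ((hc θ).symm.trans hax)
    have h2 : c τ = e := smul_left_injective ℂ hx0 ((hc τ).symm.trans (he x))
    rwa [h1, h2]
  -- `s θ` has two eigenvalues and `s τ` only `e`, so one of the two differs from `e`.
  by_cases h : a = e
  · exact key y b hy hby (fun h' => hab (h.trans h'.symm))
  · exact key x a hx hax h

/-- For any two different members of a family of isometries there is a product of simultaneous
conjugates that has a common eigenvector, with different eigenvalues at these two members. -/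
theorem exists_word {u : Θ → (E ≃ₗᵢ[ℂ] E)} {ψ : E} (hψ : ‖ψ‖ = 1) {θ τ : Θ} (hne : u θ ≠ u τ) :
    ∃ w ∈ conjMonoid u, ∃ (x : E) (c : Θ → ℂ), ‖x‖ = 1 ∧ (∀ σ, w σ x = c σ • x) ∧ c θ ≠ c τ := by
  by_cases hθτ : u θ * (u τ)⁻¹ ∈ scalars E
  swap
  · by_cases hθ : u θ ∈ scalars E
    · have hτ : u τ ∉ scalars E := fun hτ => hθτ (mul_mem hθ (inv_mem hτ))
      obtain ⟨w, hw, x, c, hx, hc, h⟩ := exists_word_of_notMem hτ (τ := θ) (fun h => hθτ (by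
        simpa using inv_mem h))
      exact ⟨w, hw, x, c, hx, hc, h.symm⟩
    · exact exists_word_of_notMem hθ hθτ
  by_contra! H
  -- The values at `θ` and `τ` differ by a scalar, which equality of the eigenvalues at `x` forces
  -- to be 1.
  have heq : ∀ w ∈ conjMonoid u, ∀ x : E, ‖x‖ = 1 → (∀ σ, ∃ c : ℂ, w σ x = c • x) →
      w θ = w τ := by
    intro w hw x hx hc
    choose c hc using hc
    have h1 := H w hw x c hx hc
    have hx0 : x ≠ 0 := by rintro rfl; simp at hx
    obtain ⟨m, hm⟩ := exists_eq_mul_of_mem_conjMonoid scalars_le_center hw (θ := θ) (τ := τ)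
      (inv_mem hθτ) (by simp)
    obtain ⟨d, hd⟩ := pow_mem (inv_mem hθτ) m
    have hw0 : w θ x ≠ 0 := by rwa [Ne, map_eq_zero_iff _ (w θ).injective]
    have h2 : w τ x = d • w θ x := by
      rw [hm, LinearIsometryEquiv.coe_mul, Function.comp_apply, hd]
    rw [hc τ, ← h1, ← hc θ] at h2
    have h3 : d = 1 := smul_left_injective ℂ hw0 (h2.symm.trans (one_smul ℂ _).symm)
    ext y
    rw [hm, LinearIsometryEquiv.coe_mul, Function.comp_apply, hd, h3, one_smul]
  classical
  -- `K` returns every `u σ ψ` to the ray of `ψ`. Its factors are conjugates of isolating words,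
  -- which agree at `θ` and `τ` by `heq`, so `K` cannot absorb the phase between `u θ` and `u τ`.
  have hK : ∀ S : Finset Θ, ∃ K ∈ conjMonoid u, K θ = K τ ∧
      ∀ σ ∈ S, ∃ c : ℂ, K σ (u σ ψ) = c • ψ := by
    intro S
    induction S using Finset.induction_on with
    | empty => exact ⟨1, one_mem _, rfl, by simp⟩
    | insert σ S _ ih =>
      obtain ⟨K, hKu, hKeq, hKS⟩ := ih
      by_cases hσ : u σ ∈ scalars E
      · refine ⟨K, hKu, hKeq, fun ρ hρ => ?_⟩
        rcases Finset.mem_insert.mp hρ with rfl | hρ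
        · obtain ⟨c, hc⟩ := mul_mem (apply_mem_of_mem_conjMonoid scalars_le_center hKu hσ) hσ
          exact ⟨c, hc ψ⟩
        · exact hKS ρ hρ
      -- A member proportional to one already treated needs no correction; otherwise the word
      -- isolating `σ` is scalar on `S` and spoils nothing there.
      by_cases hex : ∃ ρ ∈ S, u σ * (u ρ)⁻¹ ∈ scalars E
      · obtain ⟨ρ, hρ, hσρ⟩ := hex
        refine ⟨K, hKu, hKeq, fun ρ' hρ' => ?_⟩
        rcases Finset.mem_insert.mp hρ' with rfl | hρ'
        · obtain ⟨m, hm⟩ := exists_eq_mul_of_mem_conjMonoid scalars_le_center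
            (mul_mem hKu (self_mem_conjMonoid u)) (θ := ρ) (τ := ρ') hσρ (by simp)
          obtain ⟨c, hc⟩ := hKS ρ hρ
          obtain ⟨d, hd⟩ := pow_mem hσρ m
          refine ⟨d * c, ?_⟩
          have := congrArg (fun g : E ≃ₗᵢ[ℂ] E => g ψ) hm
          change K ρ' (u ρ' ψ) = ((u ρ' * (u ρ)⁻¹) ^ m) (K ρ (u ρ ψ)) at this
          rw [this, hd, hc, smul_smul]
        · exact hKS ρ' hρ'
      · push Not at hex
        obtain ⟨s, hs, hsσ, hsc⟩ := exists_isolating_word hσ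
        obtain ⟨x, -, a, -, hx, -, hax, -, -⟩ := exists_eigenvectors_of_notMem_scalars hsσ
        have hsθτ := heq s hs x hx (exists_smul_of_isolating hs hsc hax)
        obtain ⟨D, hD, c, hc⟩ := exists_mem_conjMonoid₁_apply_eq hsσ
          (x := K σ (u σ ψ)) (by rw [(K σ).norm_map, (u σ).norm_map, hψ]) hψ
        obtain ⟨t, ht, rfl⟩ := exists_mem_conjMonoid_apply hD
        obtain ⟨m, hm⟩ := exists_eq_mul_of_mem_conjMonoid scalars_le_center ht (θ := θ) (τ := τ)
          (one_mem _) (by rw [one_mul, hsθτ])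
        refine ⟨t * K, mul_mem (conjMonoid_mono hs ht) hKu, ?_, fun ρ hρ => ?_⟩
        · rw [Pi.mul_apply, Pi.mul_apply, hKeq, hm, one_pow, one_mul]
        rcases Finset.mem_insert.mp hρ with rfl | hρ
        · exact ⟨c, hc⟩
        · obtain ⟨d, hd⟩ := hKS ρ hρ
          obtain ⟨e, he⟩ := apply_mem_of_mem_conjMonoid scalars_le_center ht (hsc ρ (hex ρ hρ))
          refine ⟨e * d, ?_⟩
          change t ρ (K ρ (u ρ ψ)) = _
          rw [hd, he, smul_smul]
  obtain ⟨K, hKu, hKeq, hKS⟩ := hK Finset.univ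
  have := heq (K * u) (mul_mem hKu (self_mem_conjMonoid u)) ψ hψ
    (fun σ => hKS σ (Finset.mem_univ σ))
  rw [Pi.mul_apply, Pi.mul_apply, hKeq] at this
  exact hne (mul_left_cancel this)

theorem exists_word_apply {u : Θ → (E ≃ₗᵢ[ℂ] E)} {ψ : E} (hψ : ‖ψ‖ = 1) {θ τ : Θ}
    (hne : u θ ≠ u τ) :
    ∃ w ∈ conjMonoid u, ∃ c : Θ → ℂ, (∀ σ, w σ ψ = c σ • ψ) ∧ c θ ≠ c τ := by
  obtain ⟨w, hw, x, c, hx, hc, h⟩ := exists_word hψ hne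
  obtain ⟨C, hC⟩ := exists_isometry_apply_eq hψ hx
  refine ⟨_, conj_mem_conjMonoid hw C, c, fun σ => ?_, h⟩
  change C⁻¹ (w σ (C ψ)) = _
  rw [inv_apply_eq_iff, hC, hc, map_smul, hC]

end Words

/-! ### Transfer to unitary matrices -/

/-- A unitary matrix as an isometry of Euclidean space. -/
def unitaryEquiv (n : Type*) [Fintype n] [DecidableEq n] :
    Matrix.unitaryGroup n ℂ ≃* (EuclideanSpace ℂ n ≃ₗᵢ[ℂ] EuclideanSpace ℂ n) :=
  let e := Matrix.toEuclideanCLM (n := n) (𝕜 := ℂ)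
  (Unitary.mapEquiv { MulEquivClass.toMulEquiv e with map_star' := map_star e }).toMulEquiv.trans
    Unitary.linearIsometryEquiv

theorem unitaryEquiv_apply {n : Type*} [Fintype n] [DecidableEq n] (A : Matrix.unitaryGroup n ℂ)
    (v : EuclideanSpace ℂ n) :
    unitaryEquiv n A v = WithLp.toLp 2 ((A : Matrix n n ℂ) *ᵥ v.ofLp) := rfl

theorem exists_unitary_word {Θ : Type*} [Fintype Θ] {n : Type*} [Fintype n] [DecidableEq n]
    {U : Θ → Matrix.unitaryGroup n ℂ} {ψ : n → ℂ} (hψ : ∑ i, ‖ψ i‖ ^ 2 = 1) {θ τ : Θ}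
    (hne : U θ ≠ U τ) :
    ∃ w ∈ conjMonoid U, ∃ c : Θ → ℂ, (∀ σ, (w σ : Matrix n n ℂ) *ᵥ ψ = c σ • ψ) ∧
      (∀ σ, ‖c σ‖ = 1) ∧ c θ ≠ c τ := by
  have hψ' : ‖WithLp.toLp 2 ψ‖ = 1 := by rw [EuclideanSpace.norm_eq]; simpa using hψ
  obtain ⟨w, hw, c, hc, h⟩ := exists_word_apply (u := fun θ => unitaryEquiv n (U θ)) hψ'
    (fun h => hne ((unitaryEquiv n).injective h))
  have hle : conjMonoid (fun θ => unitaryEquiv n (U θ)) ≤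
      (conjMonoid U).map (MonoidHom.pi fun θ =>
        (unitaryEquiv n).toMonoidHom.comp (Pi.evalMonoidHom (fun _ => _) θ)) := by
    refine conjMonoid_le fun C => ⟨_, Submonoid.subset_closure ⟨(unitaryEquiv n).symm C, rfl⟩, ?_⟩
    ext θ : 1
    change unitaryEquiv n (((unitaryEquiv n).symm C)⁻¹ * U θ * (unitaryEquiv n).symm C) = _
    simp
  obtain ⟨w, hw', rfl⟩ := hle hw
  have hc' : ∀ σ, unitaryEquiv n (w σ) (WithLp.toLp 2 ψ) = c σ • WithLp.toLp 2 ψ := hc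
  refine ⟨w, hw', c, fun σ => ?_, fun σ => ?_, h⟩
  · exact congrArg WithLp.ofLp (hc' σ)
  · have := congrArg norm (hc' σ)
    rw [LinearIsometryEquiv.norm_map, norm_smul, hψ', mul_one] at this
    exact this.symm

theorem kronecker_mulVec_apply {a a' b b' : Type*} [Fintype a'] [Fintype b'] (A : Matrix a a' ℂ)
    (B : Matrix b b' ℂ) (f : a' × b' → ℂ) (i : a) (j : b) :
    ((A ⊗ₖ B) *ᵥ f) (i, j) = (A *ᵥ fun k => (B *ᵥ fun l => f (k, l)) j) i := by
  simp only [Matrix.mulVec, dotProduct, Fintype.sum_prod_type, Matrix.kroneckerMap_apply,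
    Finset.mul_sum, mul_assoc]

/-! ### Rounds as phase shifts of the control -/

section Rounds

variable {W : Type} [Fintype W] [DecidableEq W] {n : Type*} [Fintype n] [DecidableEq n]

/-- The vector whose components with control `0` and `1` are given by `x` and `y`. -/
def branches (x y : W → n → ℂ) : (W × Fin 2) × n → ℂ :=
  fun p => if p.1.2 = 0 then x p.1.1 p.2 else y p.1.1 p.2

omit [Fintype W] [DecidableEq W] [Fintype n] [DecidableEq n] in
theorem branches_ext {f : (W × Fin 2) × n → ℂ} {x y : W → n → ℂ}
    (h0 : ∀ w i, f ((w, 0), i) = x w i) (h1 : ∀ w i, f ((w, 1), i) = y w i) :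
    f = branches x y := by
  funext ⟨⟨w, c⟩, i⟩
  fin_cases c
  · exact h0 w i
  · exact h1 w i

theorem controlled_mulVec_branches (U : Matrix n n ℂ) (x y : W → n → ℂ) :
    controlled W U *ᵥ branches x y = branches x fun w => U *ᵥ y w := by
  have h : ∀ (c c' : Fin 2) (g : W × Fin 2 → ℂ) (w : W) (d : Fin 2),
      (((1 : Matrix W W ℂ) ⊗ₖ Matrix.single c c' (1 : ℂ)) *ᵥ g) (w, d) =
        if d = c then g (w, c') else 0 := by
    intro c c' g w d
    rw [kronecker_mulVec_apply, Matrix.one_mulVec]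
    by_cases hd : d = c
    · subst hd; simp [Matrix.mulVec, dotProduct, Matrix.single_apply]
    · simp [hd, Ne.symm hd, Matrix.mulVec, dotProduct]
  refine branches_ext (fun w i => ?_) (fun w i => ?_)
  · simp [controlled, Matrix.add_mulVec, kronecker_mulVec_apply (b := n), h, branches]
  · simp [controlled, Matrix.add_mulVec, kronecker_mulVec_apply (b := n), h, branches]

theorem call_branches (U : Matrix n n ℂ) (x y : W → n → ℂ) (B : Matrix.unitaryGroup n ℂ) :
    call U (branches x y) B =
      branches (fun w => (B : Matrix n n ℂ) *ᵥ x w)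
        (fun w => U *ᵥ ((B : Matrix n n ℂ) *ᵥ y w)) := by
  rw [call, ← controlled_mulVec_branches]
  congr 1
  refine branches_ext (fun w i => ?_) (fun w i => ?_) <;>
    simp [kronecker_mulVec_apply, branches]

/-- A product of conjugates can be called by one word of a round, up to a unitary that does not
depend on the black box. -/
theorem exists_word_foldl_call {Θ : Type*} {U w : Θ → Matrix.unitaryGroup n ℂ}
    (hw : w ∈ conjMonoid U) (R : Matrix.unitaryGroup n ℂ) :
    ∃ (L : List (Matrix.unitaryGroup n ℂ)) (R' : Matrix.unitaryGroup n ℂ),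
      ∀ θ (x y : W → n → ℂ),
        L.foldl (call (U θ : Matrix n n ℂ))
          (branches (fun a => (R : Matrix n n ℂ) *ᵥ x a) fun a => (R : Matrix n n ℂ) *ᵥ y a) =
        branches (fun a => (R' : Matrix n n ℂ) *ᵥ x a)
          fun a => (R' : Matrix n n ℂ) *ᵥ ((w θ : Matrix n n ℂ) *ᵥ y a) := by
  induction hw using Submonoid.closure_induction generalizing R with
  | mem w hw =>
    obtain ⟨C, rfl⟩ := hw
    -- The accumulated `R` is replaced by `C` in both branches, and `U θ * C = C * (C⁻¹ * U θ * C)`.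
    refine ⟨[C * R⁻¹], C, fun θ x y => ?_⟩
    rw [List.foldl_cons, List.foldl_nil, call_branches]
    simp only [Matrix.mulVec_mulVec, ← Matrix.UnitaryGroup.mul_val]
    simp only [mul_assoc, inv_mul_cancel, mul_one, mul_inv_cancel_left]
  | one => exact ⟨[], R, fun θ x y => by simp⟩
  | mul w w' _ _ h h' =>
    obtain ⟨L', R₁, h'⟩ := h' R
    obtain ⟨L, R₂, h⟩ := h R₁
    refine ⟨L' ++ L, R₂, fun θ x y => ?_⟩
    rw [List.foldl_append, h', h]
    simp [Matrix.mulVec_mulVec]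

/-- A pure product state. -/
def prodState {a : Type*} (χ : a → ℂ) (v : n → ℂ) : a × n → ℂ := fun p => χ p.1 * v p.2

omit [DecidableEq n] in
theorem kronecker_mulVec_prodState {a b : Type*} [Fintype a] (A : Matrix b a ℂ)
    (B : Matrix n n ℂ) (χ : a → ℂ) (v : n → ℂ) :
    (A ⊗ₖ B) *ᵥ prodState χ v = prodState (A *ᵥ χ) (B *ᵥ v) := by
  funext ⟨i, j⟩
  rw [kronecker_mulVec_apply]
  simp only [prodState]
  have : (fun k => (B *ᵥ fun l => χ k * v l) j) = fun k => (B *ᵥ v) j * χ k := by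
    funext k
    change (B *ᵥ (χ k • v)) j = _
    rw [Matrix.mulVec_smul, Pi.smul_apply, smul_eq_mul, mul_comm]
  rw [this]
  change (A *ᵥ ((B *ᵥ v) j • χ)) i = _
  rw [Matrix.mulVec_smul, Pi.smul_apply, smul_eq_mul, mul_comm]

/-- The multiplication of the component with control `1` by `c`. -/
def phaseShift (c : ℂ) (χ : W × Fin 2 → ℂ) : W × Fin 2 → ℂ :=
  fun p => χ p * if p.2 = 0 then 1 else c

/-- A function of the parameter that occurs as the eigenvalue of a word at `ψ`. -/
def IsPhase {Θ : Type*} (U : Θ → Matrix.unitaryGroup n ℂ) (ψ : n → ℂ) (c : Θ → ℂ) : Prop :=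
  (∃ w ∈ conjMonoid U, ∀ θ, (w θ : Matrix n n ℂ) *ᵥ ψ = c θ • ψ) ∧ ∀ θ, ‖c θ‖ = 1

/-- The trivial phase allows rounds that effectively only perform a side operation. -/
theorem isPhase_one {Θ : Type*} (U : Θ → Matrix.unitaryGroup n ℂ) (ψ : n → ℂ) :
    IsPhase U ψ 1 :=
  ⟨⟨1, one_mem _, fun θ => by simp⟩, fun θ => by simp⟩

theorem exists_word_run {Θ : Type*} {U : Θ → Matrix.unitaryGroup n ℂ} {ψ : n → ℂ} {c : Θ → ℂ}
    (hc : IsPhase U ψ c) (A : Matrix.unitaryGroup (W × Fin 2) ℂ) (R : Matrix.unitaryGroup n ℂ) :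
    ∃ (r : Round W n) (R' : Matrix.unitaryGroup n ℂ), ∀ θ χ,
      r.run (U θ : Matrix n n ℂ) (prodState χ ((R : Matrix n n ℂ) *ᵥ ψ)) =
        prodState (phaseShift (c θ) ((A : Matrix (W × Fin 2) (W × Fin 2) ℂ) *ᵥ χ))
          ((R' : Matrix n n ℂ) *ᵥ ψ) := by
  obtain ⟨⟨w, hw, hwc⟩, -⟩ := hc
  obtain ⟨L, R', h⟩ := exists_word_foldl_call (W := W) hw R
  refine ⟨⟨A, L⟩, R', fun θ χ => ?_⟩
  rw [Round.run, kronecker_mulVec_prodState, Matrix.one_mulVec]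
  generalize (A : Matrix (W × Fin 2) (W × Fin 2) ℂ) *ᵥ χ = χ'
  have h1 : prodState χ' ((R : Matrix n n ℂ) *ᵥ ψ) =
      branches (fun a => (R : Matrix n n ℂ) *ᵥ (χ' (a, 0) • ψ))
        (fun a => (R : Matrix n n ℂ) *ᵥ (χ' (a, 1) • ψ)) :=
    branches_ext (fun w i => by simp [prodState, Matrix.mulVec_smul])
      (fun w i => by simp [prodState, Matrix.mulVec_smul])
  rw [h1, h, eq_comm]
  refine branches_ext (fun a i => ?_) (fun a i => ?_)
  · simp [prodState, phaseShift, Matrix.mulVec_smul]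
  · simp [prodState, phaseShift, Matrix.mulVec_smul, hwc, mul_assoc]

/-- The evolution of work space and control under side operations and phase shifts. -/
def evolve {Θ : Type*} (d : List (Matrix.unitaryGroup (W × Fin 2) ℂ × (Θ → ℂ))) (θ : Θ)
    (χ : W × Fin 2 → ℂ) : W × Fin 2 → ℂ :=
  d.foldl (fun χ s => phaseShift (s.2 θ) ((s.1 : Matrix (W × Fin 2) (W × Fin 2) ℂ) *ᵥ χ)) χ

theorem exists_rounds {Θ : Type*} {U : Θ → Matrix.unitaryGroup n ℂ} {ψ : n → ℂ}
    (d : List (Matrix.unitaryGroup (W × Fin 2) ℂ × (Θ → ℂ))) (hd : ∀ s ∈ d, IsPhase U ψ s.2)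
    (R₀ : Matrix.unitaryGroup n ℂ) :
    ∃ (l : List (Round W n)) (R : ℕ → Matrix.unitaryGroup n ℂ), l.length = d.length ∧
      ∀ t θ χ, (l.take t).foldl (Round.run (U θ : Matrix n n ℂ))
        (prodState χ ((R₀ : Matrix n n ℂ) *ᵥ ψ)) =
          prodState (evolve (d.take t) θ χ) ((R t : Matrix n n ℂ) *ᵥ ψ) := by
  induction d generalizing R₀ with
  | nil => exact ⟨[], fun _ => R₀, rfl, fun t θ χ => by simp [evolve]⟩
  | cons s d ih =>
    obtain ⟨r, R', hr⟩ := exists_word_run (hd s List.mem_cons_self) s.1 R₀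
    obtain ⟨l, R, hl, h⟩ := ih (fun s hs => hd s (List.mem_cons_of_mem _ hs)) R'
    refine ⟨r :: l, fun t => Nat.casesOn t R₀ R, by simp [hl], fun t θ χ => ?_⟩
    cases t with
    | zero => simp [evolve]
    | succ t =>
      rw [List.take_succ_cons, List.foldl_cons, hr, h, List.take_succ_cons]
      rfl

theorem sum_norm_sq_mulVec (A : Matrix.unitaryGroup n ℂ) (v : n → ℂ) :
    ∑ i, ‖((A : Matrix n n ℂ) *ᵥ v) i‖ ^ 2 = ∑ i, ‖v i‖ ^ 2 := by
  have h := (unitaryEquiv n A).norm_map (WithLp.toLp 2 v)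
  rw [unitaryEquiv_apply, ← sq_eq_sq₀ (norm_nonneg _) (norm_nonneg _), EuclideanSpace.norm_sq_eq,
    EuclideanSpace.norm_sq_eq] at h
  exact h

theorem sum_norm_sq_evolve {Θ : Type*} {d : List (Matrix.unitaryGroup (W × Fin 2) ℂ × (Θ → ℂ))}
    {θ : Θ} (hd : ∀ s ∈ d, ‖s.2 θ‖ = 1) (χ : W × Fin 2 → ℂ) :
    ∑ a, ‖evolve d θ χ a‖ ^ 2 = ∑ a, ‖χ a‖ ^ 2 := by
  induction d generalizing χ with
  | nil => rfl
  | cons s d ih =>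
    refine (ih (fun s hs => hd s (List.mem_cons_of_mem _ hs)) _).trans ?_
    rw [← sum_norm_sq_mulVec s.1 χ]
    refine Finset.sum_congr rfl fun a _ => ?_
    have := hd s List.mem_cons_self
    simp only [phaseShift]
    split_ifs <;> simp [this]

omit [DecidableEq W] [Fintype n] [DecidableEq n] in
theorem reduced_prodState (χ : W × Fin 2 → ℂ) (v : n → ℂ) (hχ : ∑ a, ‖χ a‖ ^ 2 = 1) :
    reduced (prodState χ v) = Matrix.vecMulVec v (star v) := by
  ext i j
  have h : ∀ a, χ a * v i * star (χ a * v j) = (‖χ a‖ ^ 2 : ℝ) * (v i * star (v j)) := by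
    intro a
    have : χ a * star (χ a) = (‖χ a‖ ^ 2 : ℝ) := by
      rw [Complex.star_def, Complex.mul_conj, Complex.normSq_eq_norm_sq]
    rw [← this, star_mul']
    ring
  simp only [reduced, prodState, Matrix.of_apply, h, Matrix.vecMulVec_apply, Pi.star_apply]
  rw [← Finset.sum_mul, ← Complex.ofReal_sum, hχ, Complex.ofReal_one, one_mul]

/-- A protocol without distortion for given phases, whose final measurement is applied to the
result of the phase shifts. -/
theorem exists_protocol {Θ : Type*} [Fintype Θ] {U : Θ → Matrix.unitaryGroup n ℂ} {ψ : n → ℂ}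
    (hψ : ∑ i, ‖ψ i‖ ^ 2 = 1)
    (d : List (Matrix.unitaryGroup (W × Fin 2) ℂ × (Θ → ℂ))) (hd : ∀ s ∈ d, IsPhase U ψ s.2)
    (χ : W × Fin 2 → ℂ) (hχ : ∑ a, ‖χ a‖ ^ 2 = 1)
    (M : Θ → Matrix (W × Fin 2) (W × Fin 2) ℂ) (hM : ∀ θ, (M θ).IsHermitian)
    (hM2 : ∀ θ, M θ * M θ = M θ) (hM1 : ∑ θ, M θ = 1) :
    ∃ P : Protocol W n Θ, P.DistortionFree U ψ ∧ ∀ θ,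
      P.prob (U θ : Matrix n n ℂ) ψ θ = ∑ a, ‖(M θ *ᵥ evolve d θ χ) a‖ ^ 2 := by
  obtain ⟨l, R, hl, h⟩ := exists_rounds d hd 1
  have hstate : ∀ (t : ℕ) (θ : Θ), (l.take t).foldl (Round.run (U θ : Matrix n n ℂ))
      (fun p => χ p.1 * ψ p.2) =
        prodState (evolve (d.take t) θ χ) ((R t : Matrix n n ℂ) *ᵥ ψ) := by
    intro t θ
    rw [← h t θ χ, Matrix.UnitaryGroup.one_val, Matrix.one_mulVec]
    rfl
  refine ⟨⟨χ, hχ, l, M, hM, hM2, hM1⟩, ⟨R, fun t _ θ => ?_⟩, fun θ => ?_⟩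
  · rw [Protocol.state, hstate, reduced_prodState, Matrix.star_mulVec, ← Matrix.mul_vecMulVec,
      ← Matrix.vecMulVec_mul, Matrix.mul_assoc]
    rw [sum_norm_sq_evolve (fun s hs => (hd s (List.mem_of_mem_take hs)).2 θ), hχ]
  · rw [Protocol.prob, Protocol.state, hstate, kronecker_mulVec_prodState, Matrix.one_mulVec, hl,
      List.take_length]
    simp only [prodState, Fintype.sum_prod_type (α₁ := W × Fin 2), norm_mul, mul_pow,
      ← Finset.mul_sum]
    simp_rw [sum_norm_sq_mulVec, hψ, mul_one]

end Rounds

/-! ### Measurements for nearly orthonormal families -/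

section Measurements

open Filter Topology InnerProductSpace

/-- The Gram–Schmidt process hardly changes a family that is nearly orthonormal. -/
theorem tendsto_norm_gramSchmidt {k : ℕ} {E : ℕ → Type*} [∀ N, NormedAddCommGroup (E N)]
    [∀ N, InnerProductSpace ℂ (E N)] (f : ∀ N, Fin k → E N)
    (hf : ∀ i j, Tendsto (fun N => inner ℂ (f N i) (f N j)) atTop (𝓝 (if i = j then 1 else 0)))
    (i : Fin k) :
    Tendsto (fun N => ‖gramSchmidt ℂ (f N) i‖) atTop (𝓝 1) := by
  have hself : ∀ N i, inner ℂ (gramSchmidt ℂ (f N) i) (f N i) =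
      (‖gramSchmidt ℂ (f N) i‖ : ℂ) ^ 2 := by
    intro N i
    conv_lhs => rw [gramSchmidt_def'' ℂ (f N) i]
    rw [inner_add_right, inner_sum, Finset.sum_eq_zero, add_zero, inner_self_eq_norm_sq_to_K]
    · rfl
    · intro l hl
      rw [inner_smul_right, gramSchmidt_orthogonal ℂ (f N) (Finset.mem_Iio.mp hl).ne', mul_zero]
  -- The induction on `i` needs all later `j` at once: in each correction term the denominator tends
  -- to 1 and the other factors to 0.
  have main : ∀ i j : Fin k, i ≤ j → Tendsto
      (fun N => inner ℂ (gramSchmidt ℂ (f N) i) (f N j)) atTop (𝓝 (if i = j then 1 else 0)) := by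
    intro i
    induction i using WellFoundedLT.induction with
    | ind i ih =>
      intro j hij
      have h1 : ∀ N, inner ℂ (gramSchmidt ℂ (f N) i) (f N j) = inner ℂ (f N i) (f N j) -
          ∑ l ∈ Finset.Iio i, starRingEnd ℂ (inner ℂ (gramSchmidt ℂ (f N) l) (f N i) /
            inner ℂ (gramSchmidt ℂ (f N) l) (f N l)) *
              inner ℂ (gramSchmidt ℂ (f N) l) (f N j) := by
        intro N
        have : gramSchmidt ℂ (f N) i = f N i - ∑ l ∈ Finset.Iio i,
            (inner ℂ (gramSchmidt ℂ (f N) l) (f N i) / (‖gramSchmidt ℂ (f N) l‖ : ℂ) ^ 2) •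
              gramSchmidt ℂ (f N) l := eq_sub_of_add_eq (gramSchmidt_def'' ℂ (f N) i).symm
        rw [this, inner_sub_left, sum_inner]
        simp only [inner_smul_left, hself]
      simp only [h1]
      have h2 : ∀ l ∈ Finset.Iio i, Tendsto (fun N =>
          starRingEnd ℂ (inner ℂ (gramSchmidt ℂ (f N) l) (f N i) /
            inner ℂ (gramSchmidt ℂ (f N) l) (f N l)) *
              inner ℂ (gramSchmidt ℂ (f N) l) (f N j)) atTop (𝓝 0) := by
        intro l hl
        have hl := Finset.mem_Iio.mp hl
        have ha := ih l hl i hl.le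
        have hb := ih l hl j (hl.le.trans hij)
        have hc := ih l hl l le_rfl
        rw [if_neg hl.ne] at ha
        rw [if_neg (hl.trans_le hij).ne] at hb
        rw [if_pos rfl] at hc
        have := ((Complex.continuous_conj.tendsto _).comp (ha.div hc one_ne_zero)).mul hb
        simpa using this
      simpa using (hf i j).sub (tendsto_finsetSum _ h2)
  have h := (main i i le_rfl).norm
  simp only [hself, if_true, norm_one] at h
  have h' := h.sqrt
  simpa using h'

variable {a Θ : Type*} [Fintype a] [DecidableEq a] [Fintype Θ]

/-- Orthonormal vectors are distinguished by a projective measurement. -/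
theorem exists_measurement [Nonempty Θ] {e : Θ → EuclideanSpace ℂ a} (he : Orthonormal ℂ e) :
    ∃ M : Θ → Matrix a a ℂ, (∀ θ, (M θ).IsHermitian) ∧ (∀ θ, M θ * M θ = M θ) ∧
      ∑ θ, M θ = 1 ∧ ∀ θ, M θ *ᵥ (e θ).ofLp = (e θ).ofLp := by
  classical
  let Q : Θ → Matrix a a ℂ := fun θ => Matrix.vecMulVec (e θ).ofLp (star (e θ).ofLp)
  have hin : ∀ θ τ, star (e θ).ofLp ⬝ᵥ (e τ).ofLp = if θ = τ then 1 else 0 := by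
    intro θ τ
    rw [← orthonormal_iff_ite.mp he θ τ, EuclideanSpace.inner_eq_star_dotProduct, dotProduct_comm]
  have hQH : ∀ θ, (Q θ).IsHermitian := fun θ => by
    simp [Q, Matrix.IsHermitian, Matrix.conjTranspose_vecMulVec]
  have hQe : ∀ θ τ, Q θ *ᵥ (e τ).ofLp = if θ = τ then (e θ).ofLp else 0 := by
    intro θ τ
    simp only [Q]
    rw [Matrix.vecMulVec_mulVec, hin]
    split_ifs <;> simp
  have hQQ : ∀ θ τ, Q θ * Q τ = if θ = τ then Q θ else 0 := by
    intro θ τ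
    conv_lhs => simp only [Q]
    rw [Matrix.mul_vecMulVec, hQe]
    split_ifs with h
    · subst h; rfl
    · simp
  obtain ⟨θ₀⟩ := ‹Nonempty Θ›
  set S := ∑ θ ∈ Finset.univ.erase θ₀, Q θ with hS
  have hSS : S * S = S := by
    rw [hS, Finset.sum_mul]
    refine Finset.sum_congr rfl fun θ hθ => ?_
    rw [Finset.mul_sum]
    simp only [hQQ, Finset.sum_ite_eq, if_pos hθ]
  -- One outcome absorbs the orthogonal complement of the span, so that the projections sum to 1.
  refine ⟨fun θ => if θ = θ₀ then 1 - S else Q θ, fun θ => ?_, fun θ => ?_, ?_, fun θ => ?_⟩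
  · dsimp only
    split_ifs
    · refine Matrix.isHermitian_one.sub ?_
      rw [Matrix.IsHermitian, hS, Matrix.conjTranspose_sum]
      exact Finset.sum_congr rfl fun θ _ => hQH θ
    · exact hQH θ
  · dsimp only
    split_ifs
    · rw [mul_sub, sub_mul, sub_mul, hSS]
      simp
    · rw [hQQ, if_pos rfl]
  · rw [← Finset.add_sum_erase _ _ (Finset.mem_univ θ₀), if_pos rfl, Finset.sum_congr rfl
      (fun θ hθ => if_neg (Finset.ne_of_mem_erase hθ)), ← hS, sub_add_cancel]
  · dsimp only
    split_ifs with h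
    · subst h
      rw [Matrix.sub_mulVec, Matrix.one_mulVec, hS, Matrix.sum_mulVec, Finset.sum_eq_zero,
        sub_zero]
      intro τ hτ
      rw [hQe, if_neg (Finset.ne_of_mem_erase hτ)]
    · rw [hQe, if_pos rfl]

-- Since `M` is self-adjoint and fixes `e`, the overlap of `e` with `χ` is that with `M χ`;
-- Cauchy–Schwarz concludes.
omit [DecidableEq a] in
theorem norm_inner_sq_le_sum_norm_sq_mulVec {M : Matrix a a ℂ} (hM : M.IsHermitian)
    {e : EuclideanSpace ℂ a} (he : ‖e‖ = 1) (hMe : M *ᵥ e.ofLp = e.ofLp)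
    (χ : EuclideanSpace ℂ a) :
    ‖inner ℂ e χ‖ ^ 2 ≤ ∑ i, ‖(M *ᵥ χ.ofLp) i‖ ^ 2 := by
  have h1 : inner ℂ e χ = inner ℂ e (WithLp.toLp 2 (M *ᵥ χ.ofLp)) := by
    rw [EuclideanSpace.inner_eq_star_dotProduct, EuclideanSpace.inner_eq_star_dotProduct]
    rw [dotProduct_comm, dotProduct_comm (WithLp.ofLp (WithLp.toLp 2 (M *ᵥ χ.ofLp))),
      Matrix.dotProduct_mulVec]
    conv_lhs => rw [← hMe, Matrix.star_mulVec, hM.eq]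
  rw [h1]
  have h2 := norm_inner_le_norm (𝕜 := ℂ) e (WithLp.toLp 2 (M *ᵥ χ.ofLp))
  rw [he, one_mul] at h2
  calc _ ≤ _ := pow_le_pow_left₀ (norm_nonneg _) h2 2
    _ = _ := EuclideanSpace.norm_sq_eq _

/-- Nearly orthonormal families are distinguished by projective measurements with a small
probability of error. -/
theorem exists_measurement_of_tendsto [Nonempty Θ] [DecidableEq Θ] {b : ℕ → Type*}
    [∀ N, Fintype (b N)]
    [∀ N, DecidableEq (b N)] (χ : ∀ N, Θ → EuclideanSpace ℂ (b N))
    (hχ : ∀ θ τ, Tendsto (fun N => inner ℂ (χ N θ) (χ N τ)) atTop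
      (𝓝 (if θ = τ then 1 else 0))) {ε : ℝ} (hε : 0 < ε) :
    ∃ N, ∃ M : Θ → Matrix (b N) (b N) ℂ, (∀ θ, (M θ).IsHermitian) ∧ (∀ θ, M θ * M θ = M θ) ∧
      ∑ θ, M θ = 1 ∧ ∀ θ, 1 - ∑ i, ‖(M θ *ᵥ (χ N θ).ofLp) i‖ ^ 2 < ε := by
  let g := Fintype.equivFin Θ
  have ht := tendsto_norm_gramSchmidt (fun N i => χ N (g.symm i)) (fun i j => by
    simpa using hχ (g.symm i) (g.symm j))
  -- The bound 0 keeps the Gram–Schmidt vectors non-zero even for `ε ≥ 1`.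
  have hlt : max (1 - ε) 0 < 1 := max_lt (by linarith) one_pos
  have hev : ∀ᶠ N in atTop, ∀ i, max (1 - ε) 0 <
      ‖gramSchmidt ℂ (fun i => χ N (g.symm i)) i‖ ^ 2 := by
    rw [eventually_all]
    intro i
    exact ((ht i).pow 2).eventually (lt_mem_nhds (by simpa using hlt))
  obtain ⟨N, hN⟩ := hev.exists
  set v := gramSchmidt ℂ (fun i => χ N (g.symm i)) with hv
  have hv0 : ∀ i, 0 < ‖v i‖ := fun i => by
    have := (le_max_right (1 - ε) 0).trans_lt (hN i)
    rw [sq_pos_iff] at this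
    exact lt_of_le_of_ne (norm_nonneg _) this.symm
  have hon : Orthonormal ℂ (fun θ => ((‖v (g θ)‖ : ℂ)⁻¹) • v (g θ)) := by
    refine ⟨fun θ => ?_, fun θ τ hne => ?_⟩
    · rw [norm_smul, norm_inv, Complex.norm_real, norm_norm, inv_mul_cancel₀ (hv0 _).ne']
    · beta_reduce
      rw [inner_smul_left, inner_smul_right, gramSchmidt_orthogonal ℂ _ (g.injective.ne hne),
        mul_zero, mul_zero]
  obtain ⟨M, h1, h2, h3, h4⟩ := exists_measurement hon
  refine ⟨N, M, h1, h2, h3, fun θ => ?_⟩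
  have h5 := norm_inner_sq_le_sum_norm_sq_mulVec (h1 θ) (hon.1 θ) (h4 θ) (χ N θ)
  have h6 : inner ℂ (v (g θ)) (χ N θ) = (‖v (g θ)‖ : ℂ) ^ 2 := by
    have h7 : χ N θ = v (g θ) + ∑ l ∈ Finset.Iio (g θ),
        (inner ℂ (v l) (χ N θ) / (‖v l‖ : ℂ) ^ 2) • v l := by
      simpa using gramSchmidt_def'' ℂ (fun i => χ N (g.symm i)) (g θ)
    rw [h7, inner_add_right, inner_sum, Finset.sum_eq_zero, add_zero, inner_self_eq_norm_sq_to_K]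
    · rfl
    · intro l hl
      rw [inner_smul_right, gramSchmidt_orthogonal ℂ _ (Finset.mem_Iio.mp hl).ne', mul_zero]
  have h8 : ‖inner ℂ ((‖v (g θ)‖ : ℂ)⁻¹ • v (g θ)) (χ N θ)‖ = ‖v (g θ)‖ := by
    have := (hv0 (g θ)).ne'
    rw [inner_smul_left, h6, norm_mul, RCLike.norm_conj, norm_inv, norm_pow, Complex.norm_real,
      norm_norm]
    field_simp
  rw [h8] at h5
  linarith [hN (g θ), le_max_left (1 - ε) 0]

end Measurements

/-! ### Qubit registers carrying the phases -/

section Registers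

/-- A permutation of a basis as a unitary matrix. -/
def permUnitary {a : Type*} [Fintype a] [DecidableEq a] (π : Equiv.Perm a) :
    Matrix.unitaryGroup a ℂ :=
  ⟨π.permMatrix ℂ, by
    rw [Matrix.mem_unitaryGroup_iff, Matrix.star_eq_conjTranspose, Matrix.conjTranspose_permMatrix,
      ← Matrix.permMatrix_mul]
    simp⟩

theorem permUnitary_mulVec {a : Type*} [Fintype a] [DecidableEq a] (π : Equiv.Perm a)
    (χ : a → ℂ) (i : a) : ((permUnitary π : Matrix a a ℂ) *ᵥ χ) i = χ (π i) := by
  change (π.permMatrix ℂ *ᵥ χ) i = _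
  rw [Matrix.permMatrix_mulVec]
  rfl

variable {S : Type} [Fintype S] [DecidableEq S]

omit [Fintype S] in
theorem swapRegister_involutive (s : S) :
    Function.Involutive fun p : (S → Fin 2) × Fin 2 => (Function.update p.1 s p.2, p.1 s) := by
  rintro ⟨w, b⟩
  simp

/-- The exchange of the control qubit with the qubit `s` of a register. -/
def swapRegister (s : S) : Equiv.Perm ((S → Fin 2) × Fin 2) :=
  (swapRegister_involutive s).toPerm

/-- Each qubit is swapped into the control, receives its phase, and is swapped back in a round of
phase 1. -/
theorem evolve_swap {Θ : Type*} (l : List S) (c : S → Θ → ℂ) (θ : Θ)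
    (χ : (S → Fin 2) × Fin 2 → ℂ) :
    evolve (l.flatMap fun s => [(permUnitary (swapRegister s), c s),
      (permUnitary (swapRegister s), 1)]) θ χ =
        fun p => χ p * (l.map fun s => if p.1 s = 0 then 1 else c s θ).prod := by
  induction l generalizing χ with
  | nil => simp [evolve]
  | cons s l ih =>
    rw [List.flatMap_cons, evolve, List.foldl_append]
    refine (ih _).trans ?_
    funext p
    rw [List.map_cons, List.prod_cons, ← mul_assoc]
    congr 1
    simp only [List.foldl_cons, List.foldl_nil, phaseShift, permUnitary_mulVec]
    have h : swapRegister s (swapRegister s p) = p := swapRegister_involutive s p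
    rw [h]
    simp only [Pi.one_apply, ite_self, mul_one]
    rfl

/-- The result of the phase shifts on a uniform superposition. -/
def phaseVector {Θ : Type*} (c : S → Θ → ℂ) (θ : Θ) :
    EuclideanSpace ℂ ((S → Fin 2) × Fin 2) :=
  WithLp.toLp 2 fun p => ((√(Fintype.card ((S → Fin 2) × Fin 2)))⁻¹ : ℝ) *
    ∏ s, if p.1 s = 0 then 1 else c s θ

/-- The sum over bit strings factorises over the qubits; the control, on which the vector does not
depend, gives a factor 2 that the normalisation cancels. -/
theorem inner_phaseVector {Θ : Type*} (c : S → Θ → ℂ) (θ τ : Θ) :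
    inner ℂ (phaseVector c θ) (phaseVector c τ) =
      ∏ s, (1 + starRingEnd ℂ (c s θ) * c s τ) / 2 := by
  have hcard : Fintype.card ((S → Fin 2) × Fin 2) = 2 ^ Fintype.card S * 2 := by
    simp
  have h1 : ∏ s, (1 + starRingEnd ℂ (c s θ) * c s τ) = ∑ w : S → Fin 2,
      ∏ s, (starRingEnd ℂ (if w s = 0 then 1 else c s θ) * if w s = 0 then 1 else c s τ) := by
    rw [← Fintype.prod_sum (fun s (b : Fin 2) =>
      starRingEnd ℂ (if b = 0 then 1 else c s θ) * if b = 0 then 1 else c s τ)]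
    simp
  have hr : (((√(Fintype.card ((S → Fin 2) × Fin 2)))⁻¹ : ℝ) : ℂ) *
      ((√(Fintype.card ((S → Fin 2) × Fin 2)))⁻¹ : ℝ) = (2 ^ Fintype.card S * 2)⁻¹ := by
    rw [← Complex.ofReal_mul, ← mul_inv, Real.mul_self_sqrt (by positivity), hcard]
    push_cast
    rfl
  rw [Finset.prod_div_distrib, h1, PiLp.inner_apply, Fintype.sum_prod_type]
  rw [div_eq_mul_inv, Finset.sum_mul]
  refine Finset.sum_congr rfl fun w _ => ?_
  simp only [phaseVector, RCLike.inner_apply', map_mul, map_prod, Complex.conj_ofReal]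
  rw [Fin.sum_univ_two, mul_mul_mul_comm, hr, Finset.prod_mul_distrib, Finset.prod_const,
    Finset.card_univ]
  field_simp
  ring

end Registers

theorem norm_one_add_conj_mul_div_two_le {z w : ℂ} (hz : ‖z‖ = 1) (hw : ‖w‖ = 1) :
    ‖(1 + starRingEnd ℂ z * w) / 2‖ ≤ 1 := by
  rw [norm_div, Complex.norm_ofNat, div_le_one two_pos]
  refine (norm_add_le _ _).trans ?_
  rw [norm_mul, RCLike.norm_conj, hz, hw, norm_one]
  norm_num

/-- Equality in the triangle inequality would force `starRingEnd ℂ z * w = 1`. -/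
theorem norm_one_add_conj_mul_div_two_lt {z w : ℂ} (hz : ‖z‖ = 1) (hw : ‖w‖ = 1) (h : z ≠ w) :
    ‖(1 + starRingEnd ℂ z * w) / 2‖ < 1 := by
  refine lt_of_le_of_ne (norm_one_add_conj_mul_div_two_le hz hw) fun he => h ?_
  rw [norm_div, Complex.norm_ofNat, div_eq_one_iff_eq two_ne_zero] at he
  have hzw : ‖starRingEnd ℂ z * w‖ = 1 := by rw [norm_mul, RCLike.norm_conj, hz, hw, one_mul]
  have h1 : starRingEnd ℂ z * z = 1 := by
    rw [mul_comm, Complex.mul_conj, Complex.normSq_eq_norm_sq, hz]; simp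
  have h2 : (1 : ℂ) = starRingEnd ℂ z * w := by
    refine eq_of_norm_eq_of_norm_add_eq (by rw [norm_one, hzw]) ?_
    rw [he, hzw, norm_one]; norm_num
  exact mul_left_cancel₀ (left_ne_zero_of_mul_eq_one h1) (h1.trans h2)

end BlackBox

end

/-! ### Assembly of the protocol -/

theorem mainTheorem2 {Θ : Type*} [Fintype Θ] [Nonempty Θ]
    {n : Type*} [Fintype n] [DecidableEq n]
    (U : Θ → Matrix.unitaryGroup n ℂ) (hU : Function.Injective U)
    (ψ : n → ℂ) (hψ : ∑ i, ‖ψ i‖ ^ 2 = 1) (ε : ℝ) (hε : 0 < ε) :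
    ∃ (W : Type) (_ : Fintype W) (_ : DecidableEq W) (P : BlackBox.Protocol W n Θ),
      P.DistortionFree U ψ ∧
      ∀ θ, 1 - P.prob (U θ : Matrix n n ℂ) ψ θ < ε := by
  classical
  have hex : ∀ p : Θ × Θ, ∃ c : Θ → ℂ, BlackBox.IsPhase U ψ c ∧ (p.1 ≠ p.2 → c p.1 ≠ c p.2) := by
    rintro ⟨θ, τ⟩
    by_cases h : θ = τ
    · exact ⟨1, BlackBox.isPhase_one U ψ, fun h' => (h' h).elim⟩
    · obtain ⟨w, hw, c, hc, hc1, hne⟩ := BlackBox.exists_unitary_word hψ (hU.ne h)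
      exact ⟨c, ⟨⟨w, hw, hc⟩, hc1⟩, fun _ => hne⟩
  choose c hc hne using hex
  let g := Fintype.equivFin (Θ × Θ)
  -- The register has `N` qubits for each ordered pair, so overlaps are `N`-th powers.
  let C : ∀ N, Fin (Fintype.card (Θ × Θ)) × Fin N → Θ → ℂ := fun N s => c (g.symm s.1)
  have hlim : ∀ θ τ, Filter.Tendsto
      (fun N => inner ℂ (BlackBox.phaseVector (C N) θ) (BlackBox.phaseVector (C N) τ)) Filter.atTop
      (nhds (if θ = τ then 1 else 0)) := by
    intro θ τ
    have heq : ∀ N, inner ℂ (BlackBox.phaseVector (C N) θ) (BlackBox.phaseVector (C N) τ) =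
        (∏ p, (1 + starRingEnd ℂ (c p θ) * c p τ) / 2) ^ N := by
      intro N
      rw [BlackBox.inner_phaseVector, Fintype.prod_prod_type, ← Equiv.prod_comp g.symm,
        ← Finset.prod_pow]
      simp only [C, Finset.prod_const, Finset.card_univ, Fintype.card_fin]
    simp only [heq]
    split_ifs with h
    · subst h
      have h1 : ∀ p, (1 + starRingEnd ℂ (c p θ) * c p θ) / 2 = 1 := by
        intro p
        rw [mul_comm, Complex.mul_conj, Complex.normSq_eq_norm_sq, (hc p).2 θ]
        norm_num
      simp [h1]
    · refine tendsto_pow_atTop_nhds_zero_of_norm_lt_one ?_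
      -- The factor of the pair `(θ, τ)` itself is strictly below 1; the others are at most 1.
      rw [norm_prod, ← Finset.mul_prod_erase _ _ (Finset.mem_univ (θ, τ))]
      refine lt_of_le_of_lt (mul_le_of_le_one_right (norm_nonneg _)
        (Finset.prod_le_one (fun _ _ => norm_nonneg _) fun p _ => ?_)) ?_
      · exact BlackBox.norm_one_add_conj_mul_div_two_le ((hc p).2 θ) ((hc p).2 τ)
      · exact BlackBox.norm_one_add_conj_mul_div_two_lt ((hc _).2 θ) ((hc _).2 τ) (hne (θ, τ) h)
  obtain ⟨N, M, hM, hM2, hM1, herr⟩ :=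
    BlackBox.exists_measurement_of_tendsto (fun N => BlackBox.phaseVector (C N)) hlim hε
  let χ : ((Fin (Fintype.card (Θ × Θ)) × Fin N) → Fin 2) × Fin 2 → ℂ := fun _ =>
    ((√(Fintype.card (((Fin (Fintype.card (Θ × Θ)) × Fin N) → Fin 2) × Fin 2)))⁻¹ : ℝ)
  have hχ : ∑ a, ‖χ a‖ ^ 2 = 1 := by
    simp only [χ, Complex.norm_real, Real.norm_eq_abs, sq_abs, Finset.sum_const,
      Finset.card_univ, nsmul_eq_mul, inv_pow, Nat.cast_nonneg, Real.sq_sqrt]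
    exact mul_inv_cancel₀ (Nat.cast_ne_zero.mpr Fintype.card_ne_zero)
  obtain ⟨P, hP, hprob⟩ := BlackBox.exists_protocol hψ
    ((Finset.univ : Finset (Fin (Fintype.card (Θ × Θ)) × Fin N)).toList.flatMap fun s =>
      [(BlackBox.permUnitary (BlackBox.swapRegister s), C N s),
        (BlackBox.permUnitary (BlackBox.swapRegister s), 1)]) (by
        intro s hs
        obtain ⟨s', -, hs⟩ := List.mem_flatMap.mp hs
        rcases List.mem_pair.mp hs with rfl | rfl
        · exact hc _
        · exact BlackBox.isPhase_one U ψ) χ hχ M hM hM2 hM1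
  refine ⟨_, inferInstance, inferInstance, P, hP, fun θ => ?_⟩
  rw [hprob, BlackBox.evolve_swap]
  simp only [Finset.prod_map_toList]
  exact herr θ
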